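/- Let $\mathcal B$ be the Bernstein algebra of entire functions $f$ for which there are $A,B>0$ with $|f(z)|\le e^{A+B|\operatorname{Im} z|}$ for all $z\in\mathbb C$. Let $\Lambda\subset\mathbb C$ be a discrete sequence, i.e. a set with finitely many points in every disc. $\Lambda$ is called $\mathcal B$-interpolating if for every family $(v_\lambda)_{\lambda\in\Lambda}$ of complex numbers such that $\sup_{\lambda\in\Lambda}|v_\lambda|e^{-C|\operatorname{Im}\lambda|}<\infty$ for some $C>0$ there is $f\in\mathcal B$ with $f(\lambda)=v_\lambda$ for all $\lambda\in\Lambda$. Put $$n_\Lambda(z,t)=\#\bigl(\Lambda\cap\overline{D(z,t)}\bigr),\qquad N_\Lambda(z,r)=\int_0^r\frac{n_\Lambda(z,t)-n_\Lambda(z,0)}{t}\,dt+n_\Lambda(z,0)\log r .$$ Assume $\Lambda\cap\mathbb R=\emptyset$, and consider the conditions (i) there is $C>0$ such that $N_\Lambda(\lambda,|\operatorname{Im}\lambda|)\le C|\operatorname{Im}\lambda|$ for all $\lambda\in\Lambda$; (ii) $\displaystyle\sup_{x\in\mathbb R}\sum_{\lambda\in\Lambda}\frac{|\operatorname{Im}\lambda|}{|x-\lambda|^2}<\infty$.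 If $\Lambda$ lies at positive distance from the real line, i.e. there is $\delta>0$ with $|\operatorname{Im}\lambda|\ge\delta$ for all $\lambda\in\Lambda$, then $\Lambda$ is $\mathcal B$-interpolating if and only if (i) and (ii) hold. Moreover, without this additional assumption, (i) and (ii) together still imply that $\Lambda$ is $\mathcal B$-interpolating, and every $\mathcal B$-interpolating $\Lambda$ satisfies (i). -/

import Mathlib

open MeasureTheory

noncomputable section

namespace BernsteinAlgebra

/-- The Bernstein algebra: entire functions `f` with `log |f z| ≤ A + B |Im z|` on `ℂ` for some
`A, B > 0` (written in exponentiated form, so that zeros of `f` need no convention). -/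
def bernstein : Set (ℂ → ℂ) :=
  {f | Differentiable ℂ f ∧
    ∃ A > (0 : ℝ), ∃ B > (0 : ℝ), ∀ z : ℂ, ‖f z‖ ≤ Real.exp (A + B * |z.im|)}

/-- Discrete sequences in `ℂ` (finite or infinite): sets with finitely many points in each disc. -/
def IsDiscreteSeq (Λ : Set ℂ) : Prop :=
  ∀ (z : ℂ) (r : ℝ), (Λ ∩ Metric.closedBall z r).Finite

/-- Interpolation sequences for the Bernstein algebra. -/
def IsInterpolating (Λ : Set ℂ) : Prop :=
  ∀ v : Λ → ℂ,
    (∃ C > (0 : ℝ), BddAbove (Set.range fun l : Λ => ‖v l‖ * Real.exp (-C * |(l : ℂ).im|))) →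
    ∃ f ∈ bernstein, ∀ l : Λ, f l = v l

/-- The counting function `n_Λ(z, t) = #(Λ ∩ closed disc (z, t))`. -/
def countingFn (Λ : Set ℂ) (z : ℂ) (t : ℝ) : ℕ :=
  (Λ ∩ Metric.closedBall z t).ncard

/-- The integrated counting function `N_Λ(z, r)`. -/
def integratedCountingFn (Λ : Set ℂ) (z : ℂ) (r : ℝ) : ℝ :=
  (∫ t in (0 : ℝ)..r, ((countingFn Λ z t : ℝ) - (countingFn Λ z 0 : ℝ)) / t)
    + (countingFn Λ z 0 : ℝ) * Real.log r

/-- `N_Λ(l, |Im l|) ≤ C |Im l|` on `Λ`, for some `C > 0`. -/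
def DensityCondition (Λ : Set ℂ) : Prop :=
  ∃ C > (0 : ℝ), ∀ l ∈ Λ, integratedCountingFn Λ l |l.im| ≤ C * |l.im|

/-- Bounded Poisson balayage: `sup_{x ∈ ℝ} ∑_{l ∈ Λ} |Im l| / |x - l|² < ∞`. -/
def CarlesonCondition (Λ : Set ℂ) : Prop :=
  (⨆ x : ℝ, ∑' l : Λ, ENNReal.ofReal (|(l : ℂ).im| / ‖(x : ℂ) - (l : ℂ)‖ ^ 2)) < ⊤

end BernsteinAlgebra

end

namespace BernsteinAlgebra

open Filter Topology Complex

/-! Necessity. Baire's theorem in ℓ^∞ makes interpolation of bounded data uniform: the constants A,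
B do not depend on the data (`IsInterpolating.exists_uniform_bound`). A function equal to 1 at λ and
to 0 on the rest of Λ, fed to Jensen's inequality on the disc of radius |Im λ| about λ, gives (i).
For (ii) one needs, for each real x, a function with uniform bounds that is 1 at x and vanishes on
Λ. It is built by interpolating δ/(x - λ), which is bounded data precisely because Λ keeps the
distance δ from ℝ; half-plane Jensen at x + iε then bounds the Poisson sum.

Sufficiency. Fix a finite T ⊆ Λ and λ ∈ T. Fold the plane along ℝ into a half-plane. The boundary
argument of the product of the reflected factors of T \ {λ} is a monotone function of x whose slope
is the Poisson balayage, bounded by (ii). It therefore stays within bounded distance of the argument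
produced by distinct points γ of a lattice (1/m)ℤ (`exists_atoms_of_balayage`). By the maximum
principle the quotient of the two products has bounded argument in the half-plane, so a fixed root
of it has positive real part, and Schwarz–Pick compares its moduli at any two points up to a power
of the hyperbolic quantity |u + conj v|²/(Re u Re v). Exchanging the zeros γ of sin(πmz) for the
points of T \ {λ} thus gives an entire function E of controlled type (`exists_generating_function`).
At λ its only loss is a Blaschke product, which (i) and (ii) bound below by e^{-O(|Im λ|)}
(`exp_le_prod_div_reflDist`).

Multiplying E by powers of sin w / w and by e^{±ikz} makes peak functions whose sum is dominated,
off a strip, by the Poisson sum in (ii); Phragmén–Lindelöf fills the strip. The constants do not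
depend on T, so compactness passes to Λ. -/

/-! ### Bernstein bounds and normal families. -/

/-- Entire functions with `|f z| ≤ exp (A + B |Im z|)` for the given constants. -/
def HasBernsteinBound (A B : ℝ) (f : ℂ → ℂ) : Prop :=
  Differentiable ℂ f ∧ ∀ z : ℂ, ‖f z‖ ≤ Real.exp (A + B * |z.im|)

theorem HasBernsteinBound.mem_bernstein {A B : ℝ} {f : ℂ → ℂ} (hf : HasBernsteinBound A B f) :
    f ∈ bernstein := by
  refine ⟨hf.1, max A 1, by positivity, max B 1, by positivity, fun z => (hf.2 z).trans ?_⟩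
  gcongr
  · exact le_max_left _ _
  · exact le_max_left _ _

theorem HasBernsteinBound.mono {A B A' B' : ℝ} {f : ℂ → ℂ} (hf : HasBernsteinBound A B f)
    (hA : A ≤ A') (hB : B ≤ B') : HasBernsteinBound A' B' f := by
  refine ⟨hf.1, fun z => (hf.2 z).trans ?_⟩
  gcongr

/-- Cauchy estimate for the derivative. -/
theorem HasBernsteinBound.norm_deriv_le {A B : ℝ} {f : ℂ → ℂ} (hf : HasBernsteinBound A B f)
    (hB : 0 ≤ B) (z : ℂ) : ‖deriv f z‖ ≤ Real.exp (A + B * (|z.im| + 1)) := by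
  have h := norm_deriv_le_of_forall_mem_sphere_norm_le (c := z) (R := 1) (f := f)
    (C := Real.exp (A + B * (|z.im| + 1))) one_pos hf.1.diffContOnCl ?_
  · simpa using h
  · intro w hw
    refine (hf.2 w).trans ?_
    have h1 : |w.im - z.im| ≤ 1 := by
      have := abs_im_le_norm (w - z)
      rw [mem_sphere_iff_norm] at hw
      simpa [hw] using this
    have h2 : |w.im| ≤ |z.im| + 1 := by
      have := abs_sub_abs_le_abs_sub w.im z.im
      linarith
    gcongr

/-- The Lipschitz constant depends only on A, B and |Im z|. This gives equicontinuity of a family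
with common constants, and later keeps f away from 0 near a real point where it is 1. -/
theorem HasBernsteinBound.dist_le {A B : ℝ} {f : ℂ → ℂ} (hf : HasBernsteinBound A B f)
    (hB : 0 ≤ B) {z w : ℂ} (h : dist w z ≤ 1) :
    dist (f z) (f w) ≤ Real.exp (A + B * (|z.im| + 2)) * dist w z := by
  have := (convex_closedBall z 1).norm_image_sub_le_of_norm_deriv_le (f := f)
    (C := Real.exp (A + B * (|z.im| + 2))) (x := z) (y := w)
    (fun x _ => hf.1 x) (fun x hx => ?_) (by simp) (by simpa using h)
  · rw [dist_comm, dist_eq_norm, dist_eq_norm]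
    exact this
  · refine (hf.norm_deriv_le hB x).trans ?_
    have h1 : |x.im - z.im| ≤ 1 := by
      have := abs_im_le_norm (x - z)
      rw [mem_closedBall_iff_norm] at hx
      simpa using this.trans hx
    have h2 : |x.im| ≤ |z.im| + 1 := by
      have := abs_sub_abs_le_abs_sub x.im z.im
      linarith
    have h3 : |x.im| + 1 ≤ |z.im| + 2 := by linarith
    gcongr

/-- Compactness: pointwise limits along ultrafilters exist and keep the bound. -/
theorem exists_tendsto_ultrafilter {ι : Type*} (U : Ultrafilter ι) {A B : ℝ} (hB : 0 ≤ B)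
    {f : ι → ℂ → ℂ} (hf : ∀ i, HasBernsteinBound A B (f i)) :
    ∃ g, HasBernsteinBound A B g ∧ ∀ z, Tendsto (fun i => f i z) U (𝓝 (g z)) := by
  have hlim : ∀ z, ∃ y ∈ Metric.closedBall (0 : ℂ) (Real.exp (A + B * |z.im|)),
      Tendsto (fun i => f i z) U (𝓝 y) := by
    intro z
    have hc := isCompact_closedBall (0 : ℂ) (Real.exp (A + B * |z.im|))
    exact hc.ultrafilter_le_nhds (U.map fun i => f i z)
      (tendsto_principal.2 (Eventually.of_forall fun i => by simpa using (hf i).2 z))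
  choose g hg hgl using hlim
  refine ⟨g, ⟨?_, fun z => by simpa using hg z⟩, hgl⟩
  have heq : Equicontinuous f := by
    intro z
    refine Metric.equicontinuousAt_of_continuity_modulus
      (fun w => Real.exp (A + B * (|z.im| + 2)) * dist w z) ?_ f ?_
    · have : Continuous fun w : ℂ => Real.exp (A + B * (|z.im| + 2)) * dist w z := by fun_prop
      simpa using this.tendsto z
    · filter_upwards [Metric.closedBall_mem_nhds z one_pos] with w hw i
      exact (hf i).dist_le hB hw
  -- Equicontinuity upgrades pointwise convergence to uniform convergence on compacts, so the limit
  -- is entire.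
  have hu := (EquicontinuousOn.tendsto_uniformOnFun_iff_pi (𝔖 := {K : Set ℂ | IsCompact K})
    (fun K hK => hK) (by
      rw [Set.eq_univ_iff_forall]
      exact fun x => ⟨{x}, isCompact_singleton, rfl⟩)
    (fun K _ => heq.equicontinuousOn K) (U : Filter ι) g).2 (tendsto_pi_nhds.2 hgl)
  rw [UniformOnFun.tendsto_iff_tendstoUniformlyOn] at hu
  have hloc : TendstoLocallyUniformlyOn f g U Set.univ := by
    rw [tendstoLocallyUniformlyOn_iff_forall_isCompact isOpen_univ]
    exact fun K _ hK => hu K hK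
  exact differentiableOn_univ.1
    (hloc.differentiableOn (Eventually.of_forall fun i => (hf i).1.differentiableOn) isOpen_univ)

/-! ### Division by zeros; the function sin w / w. -/

theorem differentiable_dslope {f : ℂ → ℂ} (hf : Differentiable ℂ f) (c : ℂ) :
    Differentiable ℂ (dslope f c) := by
  rw [← differentiableOn_univ, Complex.differentiableOn_dslope univ_mem]
  exact hf.differentiableOn

theorem eq_sub_mul_dslope {f : ℂ → ℂ} {c : ℂ} (hc : f c = 0) (z : ℂ) :
    f z = (z - c) * dslope f c z := by
  have := sub_smul_dslope f c z
  rw [smul_eq_mul, hc, sub_zero] at this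
  exact this.symm

/-- Division of an entire function by a polynomial with simple zeros. -/
theorem exists_eq_mul_prod_sub {ι : Type*} (s : Finset ι) (c : ι → ℂ) (hc : Set.InjOn c s)
    {f : ℂ → ℂ} (hf : Differentiable ℂ f) (h0 : ∀ i ∈ s, f (c i) = 0) :
    ∃ R : ℂ → ℂ, Differentiable ℂ R ∧ ∀ z, f z = R z * ∏ i ∈ s, (z - c i) := by
  classical
  induction s using Finset.induction_on with
  | empty => exact ⟨f, hf, by simp⟩
  | insert j s hj ih =>
    obtain ⟨R, hR, hfR⟩ := ih (hc.mono (by simp)) fun i hi => h0 i (Finset.mem_insert_of_mem hi)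
    have hRj : R (c j) = 0 := by
      have h1 := h0 j (Finset.mem_insert_self _ _)
      rw [hfR] at h1
      refine (mul_eq_zero.1 h1).resolve_right (Finset.prod_ne_zero_iff.2 fun i hi h => ?_)
      have := hc (Finset.mem_coe.2 (Finset.mem_insert_self j s))
        (Finset.mem_coe.2 (Finset.mem_insert_of_mem hi)) (sub_eq_zero.1 h)
      exact hj (this ▸ hi)
    refine ⟨dslope R (c j), differentiable_dslope hR _, fun z => ?_⟩
    rw [hfR, Finset.prod_insert hj, eq_sub_mul_dslope hRj z]
    ring

theorem norm_exp_mul_I_le (w : ℂ) : ‖Complex.exp (w * I)‖ ≤ Real.exp |w.im| := by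
  rw [Complex.norm_exp]
  simpa using neg_le_abs w.im

theorem norm_sin_le (w : ℂ) : ‖Complex.sin w‖ ≤ Real.exp |w.im| := by
  have h1 := norm_exp_mul_I_le w
  have h2 := norm_exp_mul_I_le (-w)
  rw [neg_im, abs_neg] at h2
  rw [Complex.sin, norm_div, norm_mul, norm_I, mul_one]
  have := norm_sub_le (Complex.exp (-w * I)) (Complex.exp (w * I))
  rw [Complex.norm_ofNat]
  linarith

theorem norm_cos_le (w : ℂ) : ‖Complex.cos w‖ ≤ Real.exp |w.im| := by
  have h1 := norm_exp_mul_I_le w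
  have h2 := norm_exp_mul_I_le (-w)
  rw [neg_im, abs_neg] at h2
  rw [Complex.cos, norm_div]
  have := norm_add_le (Complex.exp (w * I)) (Complex.exp (-w * I))
  rw [Complex.norm_ofNat]
  linarith

/-- The entire function `sin w / w`. -/
noncomputable def csinc : ℂ → ℂ := dslope Complex.sin 0

theorem differentiable_csinc : Differentiable ℂ csinc :=
  differentiable_dslope Complex.differentiable_sin 0

theorem csinc_zero : csinc 0 = 1 := by simp [csinc, dslope_same]

theorem sin_eq_mul_csinc (w : ℂ) : Complex.sin w = w * csinc w := by
  simpa [csinc] using eq_sub_mul_dslope Complex.sin_zero w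

/-- Mean value inequality for sin between 0 and w, inside the convex strip |Im u| ≤ |Im w| where
|cos u| ≤ e^{|Im w|}. -/
theorem norm_csinc_le (w : ℂ) : ‖csinc w‖ ≤ Real.exp |w.im| := by
  rcases eq_or_ne w 0 with rfl | hw
  · simp [csinc_zero]
  have hconv : Convex ℝ {u : ℂ | |u.im| ≤ |w.im|} := by
    have : {u : ℂ | |u.im| ≤ |w.im|} = Complex.imLm ⁻¹' (Set.Icc (-|w.im|) |w.im|) := by
      ext u; simp [abs_le]
    rw [this]
    exact (convex_Icc _ _).linear_preimage _
  have := hconv.norm_image_sub_le_of_norm_deriv_le (f := Complex.sin)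
    (C := Real.exp |w.im|) (x := 0) (y := w) (fun x _ => Complex.differentiable_sin x)
    (fun x hx => by
      rw [Complex.deriv_sin]
      exact (norm_cos_le x).trans (Real.exp_le_exp.2 hx)) (by simp) (by simp)
  rw [Complex.sin_zero, sub_zero, sub_zero, sin_eq_mul_csinc, norm_mul, mul_comm] at this
  exact le_of_mul_le_mul_right this (norm_pos_iff.2 hw)

theorem norm_csinc_mul_norm_le (w : ℂ) : ‖csinc w‖ * ‖w‖ ≤ Real.exp |w.im| := by
  rw [← norm_mul, mul_comm, ← sin_eq_mul_csinc]
  exact norm_sin_le w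

theorem norm_csinc_mul_one_add_le (w : ℂ) : ‖csinc w‖ * (1 + ‖w‖) ≤ 2 * Real.exp |w.im| := by
  linarith [norm_csinc_le w, norm_csinc_mul_norm_le w]

/-! ### Half-plane Phragmén–Lindelöf and uniform interpolation constants. -/

/-- Phragmén–Lindelöf principle for bounded functions in the right half-plane. -/
theorem norm_le_of_bounded_of_imaginary_axis {F : ℂ → ℂ} {C M : ℝ}
    (hd : DiffContOnCl ℂ F {z | 0 < z.re}) (hb : ∀ z : ℂ, 0 < z.re → ‖F z‖ ≤ C)
    (hM : ∀ x : ℝ, ‖F (x * I)‖ ≤ M) {z : ℂ} (hz : 0 ≤ z.re) : ‖F z‖ ≤ M := by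
  refine PhragmenLindelof.right_half_plane_of_bounded_on_real hd ⟨1, by norm_num, 0, ?_⟩ ?_ hM hz
  · refine Asymptotics.IsBigO.of_bound C ?_
    filter_upwards [mem_inf_of_right (mem_principal_self {z : ℂ | 0 < z.re})] with w hw
    simpa using hb w hw
  · refine ⟨C, ?_⟩
    rw [eventually_map]
    filter_upwards [eventually_gt_atTop 0] with x hx
    exact hb x (by simpa using hx)

/-- Interpolation with uniform constants. -/
theorem IsInterpolating.exists_uniform_bound {Λ : Set ℂ} (h : IsInterpolating Λ) :
    ∃ A B : ℝ, 0 ≤ B ∧ ∀ v : Λ → ℂ, (∀ l, ‖v l‖ ≤ 1) →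
      ∃ f, HasBernsteinBound A B f ∧ ∀ l : Λ, f l = v l := by
  classical
  let E := lp (fun _ : Λ => ℂ) ⊤
  -- Baire: the sets of data interpolated with constants (n, n) are closed by compactness and cover
  -- ℓ^∞, so one of them contains a ball.
  let S : ℕ → Set E := fun n => {v | ∃ f, HasBernsteinBound n n f ∧ ∀ l : Λ, f l = v l}
  have hclosed : ∀ n, IsClosed (S n) := by
    intro n
    rw [isClosed_iff_ultrafilter]
    intro x u hux hS
    have hex : ∀ i : E, ∃ f, HasBernsteinBound n n f ∧ (i ∈ S n → ∀ l : Λ, f l = i l) := by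
      intro i
      by_cases hi : i ∈ S n
      · obtain ⟨f, hf, hfi⟩ := hi
        exact ⟨f, hf, fun _ => hfi⟩
      · exact ⟨0, ⟨differentiable_const _, fun z => by simpa using (Real.exp_pos _).le⟩,
          fun h => absurd h hi⟩
    choose f hf hfi using hex
    obtain ⟨g, hg, hgl⟩ := exists_tendsto_ultrafilter u n.cast_nonneg hf
    refine ⟨g, hg, fun l => tendsto_nhds_unique (hgl l) ?_⟩
    have hcont : Continuous fun i : E => i l :=
      (continuous_apply l).comp (lp.uniformContinuous_coe (E := fun _ : Λ => ℂ)).continuous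
    refine ((hcont.tendsto x).mono_left hux).congr' ?_
    filter_upwards [hS] with i hi
    exact (hfi i hi l).symm
  have hunion : ⋃ n, S n = Set.univ := by
    rw [Set.eq_univ_iff_forall]
    intro v
    obtain ⟨f, ⟨hf, A, -, B, -, hAB⟩, hfv⟩ := h (fun l => v l) ⟨1, one_pos, ‖v‖, by
      rintro _ ⟨l, rfl⟩
      have h1 := lp.norm_apply_le_norm (by simp) v l
      have h2 : Real.exp (-1 * |(l : ℂ).im|) ≤ 1 := by
        rw [Real.exp_le_one_iff]
        linarith [abs_nonneg (l : ℂ).im]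
      calc ‖v l‖ * Real.exp (-1 * |(l : ℂ).im|) ≤ ‖v l‖ * 1 := by gcongr
        _ ≤ ‖v‖ := by rwa [mul_one]⟩
    obtain ⟨n, hn⟩ := exists_nat_ge (max A B)
    have hfAB : HasBernsteinBound A B f := ⟨hf, hAB⟩
    exact Set.mem_iUnion.2 ⟨n, f, hfAB.mono ((le_max_left _ _).trans hn)
      ((le_max_right _ _).trans hn), hfv⟩
  obtain ⟨n, v₀, hv₀⟩ := nonempty_interior_of_iUnion_of_closed hclosed hunion
  obtain ⟨ε, hε, hball⟩ := Metric.mem_nhds_iff.1 (mem_interior_iff_mem_nhds.1 hv₀)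
  obtain ⟨f₀, hf₀, hfv₀⟩ := hball (Metric.mem_ball_self hε)
  -- With f₀ and f₁ interpolating v₀ and v₀ + (ε/2)v, the function (2/ε)(f₁ - f₀) interpolates v;
  -- the two bounds e^{n + n|Im z|} add up to the factor 4/ε.
  refine ⟨Real.log (4 / ε) + n, n, n.cast_nonneg, fun v hv => ?_⟩
  have hmem : Memℓp v ⊤ := memℓp_infty ⟨1, by rintro _ ⟨l, rfl⟩; exact hv l⟩
  let u : E := ⟨v, hmem⟩
  have hu : ‖u‖ ≤ 1 := lp.norm_le_of_forall_le zero_le_one hv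
  obtain ⟨f₁, hf₁, hfv₁⟩ := hball (a := v₀ + ((ε / 2 : ℝ) : ℂ) • u) (by
    rw [Metric.mem_ball, dist_eq_norm, add_sub_cancel_left, norm_smul, norm_real,
      Real.norm_of_nonneg (by positivity)]
    nlinarith [norm_nonneg u])
  refine ⟨fun z => ((2 / ε : ℝ) : ℂ) * (f₁ z - f₀ z), ⟨?_, fun z => ?_⟩, fun l => ?_⟩
  · exact (hf₁.1.sub hf₀.1).const_mul _
  · have h1 := hf₁.2 z
    have h0 := hf₀.2 z
    have h2 := norm_sub_le (f₁ z) (f₀ z)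
    rw [norm_mul, norm_real, Real.norm_of_nonneg (by positivity), add_assoc, Real.exp_add,
      Real.exp_log (by positivity)]
    calc 2 / ε * ‖f₁ z - f₀ z‖
        ≤ 2 / ε * (Real.exp (n + n * |z.im|) + Real.exp (n + n * |z.im|)) := by
          gcongr; linarith
      _ = _ := by ring
  · have hval : (v₀ + ((ε / 2 : ℝ) : ℂ) • u : E) l = v₀ l + ((ε / 2 : ℝ) : ℂ) * v l := rfl
    simp only [hfv₁, hfv₀]
    rw [hval, add_sub_cancel_left, ← mul_assoc, ← ofReal_mul]
    have : 2 / ε * (ε / 2) = 1 := by field_simp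
    rw [this, ofReal_one, one_mul]

/-! ### Jensen inequalities. -/

/-- Jensen's inequality for finitely many zeros in a disc. -/
theorem norm_mul_prod_div_dist_le {c : ℂ} {R M : ℝ} (hR : 0 < R) (s : Finset ℂ) {f : ℂ → ℂ}
    (hs : ∀ w ∈ s, w ≠ c) (hf : Differentiable ℂ f) (h0 : ∀ w ∈ s, f w = 0)
    (hM : ∀ z, ‖z - c‖ = R → ‖f z‖ ≤ M) : ‖f c‖ * ∏ w ∈ s, R / dist w c ≤ M := by
  induction s using Finset.induction_on generalizing f with
  | empty =>
    have := Complex.norm_le_of_forall_mem_frontier_norm_le (U := Metric.ball c R) (C := M)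
      Metric.isBounded_ball hf.diffContOnCl (fun z hz => by
        rw [frontier_ball c hR.ne', mem_sphere_iff_norm] at hz
        exact hM z hz) (z := c) (subset_closure (Metric.mem_ball_self hR))
    simpa using this
  | insert w s hw ih =>
    have hfw := h0 w (Finset.mem_insert_self _ _)
    have hwc := hs w (Finset.mem_insert_self _ _)
    -- The factor z - w is traded for its reflection in the circle, which has the same modulus on |z
    -- - c| = R and modulus R at the centre.
    have key := ih (f := fun z => dslope f w z *
        ((R ^ 2 - (z - c) * (starRingEnd ℂ) (w - c)) / R))
      (fun w' hw' => hs w' (Finset.mem_insert_of_mem hw'))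
      ((differentiable_dslope hf w).mul (by fun_prop)) (fun w' hw' => ?_) (fun z hz => ?_)
    · simp only [sub_self, zero_mul, sub_zero, norm_mul, norm_div, norm_pow, norm_real,
        Real.norm_of_nonneg hR.le] at key
      rw [Finset.prod_insert hw, eq_sub_mul_dslope hfw c, norm_mul]
      have hpos : 0 < ‖c - w‖ := norm_pos_iff.2 (sub_ne_zero.2 hwc.symm)
      rw [dist_comm w c, dist_eq_norm c w]
      calc _ = ‖dslope f w c‖ * (R ^ 2 / R) * ∏ w ∈ s, R / dist w c := by field_simp
        _ ≤ M := key
    · have hne : w' - w ≠ 0 := sub_ne_zero.2 fun h => hw (h ▸ hw')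
      have h1 := h0 w' (Finset.mem_insert_of_mem hw')
      rw [eq_sub_mul_dslope hfw w'] at h1
      simp [(mul_eq_zero.1 h1).resolve_left hne]
    · have hRz : (R : ℂ) ^ 2 = (z - c) * (starRingEnd ℂ) (z - c) := by
        rw [mul_conj, normSq_eq_norm_sq, hz]; push_cast; ring
      have h1 : ‖((R : ℂ) ^ 2 - (z - c) * (starRingEnd ℂ) (w - c)) / R‖ = ‖z - w‖ := by
        rw [hRz, ← mul_sub, ← map_sub, sub_sub_sub_cancel_right, norm_div, norm_mul, hz,
          Complex.norm_conj, norm_real, Real.norm_of_nonneg hR.le]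
        field_simp
      rw [norm_mul, h1, mul_comm, ← norm_mul, ← eq_sub_mul_dslope hfw]
      exact hM z hz

/-- Jensen's inequality for finitely many zeros in the upper half-plane. -/
theorem norm_mul_prod_conj_le {B M : ℝ} (hB : 0 ≤ B) (s : Finset ℂ) {f : ℂ → ℂ}
    (hs : ∀ w ∈ s, 0 < w.im) (hf : Differentiable ℂ f) (h0 : ∀ w ∈ s, f w = 0)
    (hC : ∃ C, ∀ z : ℂ, 0 ≤ z.im → ‖f z‖ ≤ C * Real.exp (B * z.im))
    (hM : ∀ x : ℝ, ‖f x‖ ≤ M) {z : ℂ} (hz : 0 ≤ z.im) :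
    ‖f z‖ * ∏ w ∈ s, ‖z - (starRingEnd ℂ) w‖ ≤ M * Real.exp (B * z.im) * ∏ w ∈ s, ‖z - w‖ := by
  induction s using Finset.induction_on generalizing f with
  | empty =>
    obtain ⟨C, hC⟩ := hC
    have hn : ∀ ζ : ℂ, ‖Complex.exp (-B * ζ)‖ = Real.exp (-(B * ζ.re)) := fun ζ => by
      rw [Complex.norm_exp]; simp
    have := norm_le_of_bounded_of_imaginary_axis (F := fun ζ => f (I * ζ) * Complex.exp (-B * ζ))
      (C := C) (M := M) (z := -I * z)
      (Differentiable.diffContOnCl (by fun_prop)) (fun ζ hζ => ?_) (fun x => ?_) (by simpa using hz)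
    · have h2 : I * (-I * z) = z := by rw [← mul_assoc]; simp
      have h3 : (-I * z).re = z.im := by simp
      simp only [h2] at this
      rw [norm_mul, hn, h3, Real.exp_neg, ← div_eq_mul_inv, div_le_iff₀ (Real.exp_pos _)] at this
      simpa using this
    · rw [norm_mul, hn, Real.exp_neg, ← div_eq_mul_inv, div_le_iff₀ (Real.exp_pos _)]
      simpa using hC (I * ζ) (by simpa using hζ.le)
    · rw [norm_mul, hn]
      have h2 : I * (x * I) = ((-x : ℝ) : ℂ) := by
        rw [mul_comm, mul_assoc, I_mul_I]; simp
      rw [h2]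
      simpa using hM (-x)
  | insert w s hw ih =>
    have hfw := h0 w (Finset.mem_insert_self _ _)
    have hwi := hs w (Finset.mem_insert_self _ _)
    obtain ⟨C, hC⟩ := hC
    have hfac : ∀ z, ‖f z‖ = ‖z - w‖ * ‖dslope f w z‖ := fun z => by
      rw [← norm_mul, ← eq_sub_mul_dslope hfw]
    have hcd : Differentiable ℂ fun z => dslope f w z * (z - (starRingEnd ℂ) w) :=
      (differentiable_dslope hf w).mul (by fun_prop)
    -- Trading z - w for z - conj w changes no modulus on ℝ. The growth bound survives: by
    -- compactness within distance 1 of w, and elsewhere because |z - conj w| ≤ (1 + 2 Im w)|z - w|.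
    have key := ih (f := fun z => dslope f w z * (z - (starRingEnd ℂ) w))
      (fun w' hw' => hs w' (Finset.mem_insert_of_mem hw')) hcd (fun w' hw' => ?_) ?_ (fun x => ?_)
    · rw [Finset.prod_insert hw, Finset.prod_insert hw, hfac]
      rw [norm_mul] at key
      calc _ = ‖z - w‖ * (‖dslope f w z‖ * ‖z - (starRingEnd ℂ) w‖ *
            ∏ w ∈ s, ‖z - (starRingEnd ℂ) w‖) := by ring
        _ ≤ ‖z - w‖ * (M * Real.exp (B * z.im) * ∏ w ∈ s, ‖z - w‖) := by gcongr
        _ = _ := by ring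
    · have hne : w' - w ≠ 0 := sub_ne_zero.2 fun h => hw (h ▸ hw')
      have h1 := h0 w' (Finset.mem_insert_of_mem hw')
      rw [eq_sub_mul_dslope hfw w'] at h1
      simp [(mul_eq_zero.1 h1).resolve_left hne]
    · obtain ⟨C₁, hC₁⟩ := (isCompact_closedBall w 1).exists_bound_of_continuousOn
        hcd.continuous.continuousOn
      refine ⟨max C₁ ((1 + 2 * w.im) * C), fun z hz => ?_⟩
      by_cases hzw : ‖z - w‖ ≤ 1
      · have h1 := hC₁ z (mem_closedBall_iff_norm.2 hzw)
        have h2 : 1 ≤ Real.exp (B * z.im) := Real.one_le_exp (by positivity)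
        have h3 : 0 ≤ C₁ := (norm_nonneg _).trans h1
        calc _ ≤ C₁ * 1 := by simpa using h1
          _ ≤ max C₁ ((1 + 2 * w.im) * C) * Real.exp (B * z.im) := by
            gcongr
            exact le_max_left _ _
      · have h1 : ‖z - (starRingEnd ℂ) w‖ ≤ (1 + 2 * w.im) * ‖z - w‖ := by
          have h2 : z - (starRingEnd ℂ) w = (z - w) + ((2 * w.im : ℝ) : ℂ) * I := by
            rw [← sub_conj]; ring
          have h3 := norm_add_le (z - w) (((2 * w.im : ℝ) : ℂ) * I)
          rw [← h2, norm_mul, norm_real, norm_I, mul_one,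
            Real.norm_of_nonneg (by positivity)] at h3
          nlinarith
        rw [norm_mul]
        calc _ ≤ ‖dslope f w z‖ * ((1 + 2 * w.im) * ‖z - w‖) := by gcongr
          _ = (1 + 2 * w.im) * ‖f z‖ := by rw [hfac]; ring
          _ ≤ (1 + 2 * w.im) * (C * Real.exp (B * z.im)) := by
            have := hC z hz
            gcongr
          _ = (1 + 2 * w.im) * C * Real.exp (B * z.im) := by ring
          _ ≤ _ := by
            gcongr
            exact le_max_right _ _
    · rw [norm_mul]
      have h1 : ‖(x : ℂ) - (starRingEnd ℂ) w‖ = ‖(x : ℂ) - w‖ := by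
        rw [← Complex.norm_conj]; simp
      rw [h1, mul_comm, ← hfac]
      exact hM x

/-! ### The integrated counting function and necessity of (i). -/

theorem integrableOn_indicator_Ici_inv {d : ℝ} (hd : 0 < d) (r : ℝ) :
    IntegrableOn (Set.indicator (Set.Ici d) fun t : ℝ => t⁻¹) (Set.Ioc 0 r) := by
  have h : IntegrableOn (fun t : ℝ => t⁻¹) (Set.Icc d r) := by
    refine ContinuousOn.integrableOn_Icc (continuousOn_inv₀.mono fun t ht => ?_)
    exact (hd.trans_le ht.1).ne'
  rw [IntegrableOn, integrable_indicator_iff measurableSet_Ici, IntegrableOn,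
    Measure.restrict_restrict measurableSet_Ici]
  exact h.mono_set fun t ht => ⟨ht.1, ht.2.2⟩

theorem setIntegral_indicator_Ici_inv {d r : ℝ} (hd : 0 < d) (hdr : d ≤ r) :
    ∫ t in Set.Ioc 0 r, Set.indicator (Set.Ici d) (fun t : ℝ => t⁻¹) t = Real.log (r / d) := by
  rw [setIntegral_indicator measurableSet_Ici]
  have : Set.Ioc 0 r ∩ Set.Ici d = Set.Icc d r := by
    ext t
    simp only [Set.mem_inter_iff, Set.mem_Ioc, Set.mem_Ici, Set.mem_Icc]
    exact ⟨fun h => ⟨h.2, h.1.2⟩, fun h => ⟨⟨hd.trans_le h.1, h.2⟩, h.1⟩⟩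
  rw [this, integral_Icc_eq_integral_Ioc, ← intervalIntegral.integral_of_le hdr,
    integral_inv_of_pos hd (hd.trans_le hdr)]

theorem countingFn_zero {Λ : Set ℂ} {l : ℂ} (hl : l ∈ Λ) : countingFn Λ l 0 = 1 := by
  have : Λ ∩ Metric.closedBall l 0 = {l} := by
    rw [Metric.closedBall_zero, Set.inter_eq_right.2 (Set.singleton_subset_iff.2 hl)]
  rw [countingFn, this, Set.ncard_singleton]

/-- The points of `Λ` other than `l` in the closed disc `(l, r)`. -/
noncomputable def neighbours {Λ : Set ℂ} (hΛ : IsDiscreteSeq Λ) (l : ℂ) (r : ℝ) : Finset ℂ :=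
  (hΛ l r).toFinset.erase l

theorem mem_neighbours {Λ : Set ℂ} (hΛ : IsDiscreteSeq Λ) {l : ℂ} {r : ℝ} {w : ℂ} :
    w ∈ neighbours hΛ l r ↔ w ≠ l ∧ w ∈ Λ ∧ dist w l ≤ r := by
  simp [neighbours]

theorem countingFn_eq {Λ : Set ℂ} (hΛ : IsDiscreteSeq Λ) {l : ℂ} (hl : l ∈ Λ) {r t : ℝ}
    (ht : 0 ≤ t) (htr : t ≤ r) :
    (countingFn Λ l t : ℝ) - 1 = ∑ w ∈ neighbours hΛ l r, if dist w l ≤ t then 1 else 0 := by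
  classical
  have hmem : l ∈ (hΛ l t).toFinset := by simp [hl, ht]
  have h1 : (neighbours hΛ l r).filter (fun w => dist w l ≤ t) = (hΛ l t).toFinset.erase l := by
    ext w
    rw [Finset.mem_filter, mem_neighbours, Finset.mem_erase, Set.Finite.mem_toFinset]
    simp only [Set.mem_inter_iff, Metric.mem_closedBall]
    exact ⟨fun h => ⟨h.1.1, h.1.2.1, h.2⟩, fun h => ⟨⟨h.1, h.2.1, h.2.2.trans htr⟩, h.2.2⟩⟩
  rw [Finset.sum_boole, h1, Finset.card_erase_of_mem hmem, countingFn,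
    Set.ncard_eq_toFinset_card _ (hΛ l t), Nat.cast_sub (Finset.card_pos.2 ⟨l, hmem⟩)]
  simp

/-- The integrated counting function as a sum of logarithms. -/
theorem integratedCountingFn_eq {Λ : Set ℂ} (hΛ : IsDiscreteSeq Λ) {l : ℂ} (hl : l ∈ Λ) {r : ℝ}
    (hr : 0 < r) : integratedCountingFn Λ l r =
      ∑ w ∈ neighbours hΛ l r, Real.log (r / dist w l) + Real.log r := by
  have hd : ∀ w ∈ neighbours hΛ l r, 0 < dist w l ∧ dist w l ≤ r := fun w hw =>
    ⟨dist_pos.2 ((mem_neighbours hΛ).1 hw).1, ((mem_neighbours hΛ).1 hw).2.2⟩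
  rw [integratedCountingFn, countingFn_zero hl, intervalIntegral.integral_of_le hr.le,
    Nat.cast_one, one_mul]
  congr 1
  rw [setIntegral_congr_fun (g := fun t => ∑ w ∈ neighbours hΛ l r,
    Set.indicator (Set.Ici (dist w l)) (fun t : ℝ => t⁻¹) t) measurableSet_Ioc]
  · rw [integral_finsetSum _ fun w hw => integrableOn_indicator_Ici_inv (hd w hw).1 r]
    exact Finset.sum_congr rfl fun w hw => setIntegral_indicator_Ici_inv (hd w hw).1 (hd w hw).2
  · intro t ht
    simp only
    rw [countingFn_eq hΛ hl ht.1.le ht.2, Finset.sum_div]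
    refine Finset.sum_congr rfl fun w _ => ?_
    by_cases h : dist w l ≤ t
    · simp [h, Set.indicator]
    · simp [h, Set.indicator]

/-- Interpolating sequences satisfy the density condition. -/
theorem IsInterpolating.densityCondition {Λ : Set ℂ} (hΛ : IsDiscreteSeq Λ)
    (hreal : ∀ l ∈ Λ, l.im ≠ 0) (h : IsInterpolating Λ) : DensityCondition Λ := by
  classical
  obtain ⟨A, B, hB, hAB⟩ := h.exists_uniform_bound
  -- 2B comes from |Im z| ≤ 2|Im l| on the Jensen circle. The rest absorbs A + log|Im l| through log
  -- t ≤ t - 1, which stays linear in |Im l| even when |Im l| is small.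
  refine ⟨2 * B + Real.exp (2 * |A|) + 1, by positivity, fun l hl => ?_⟩
  have hr : 0 < |l.im| := abs_pos.2 (hreal l hl)
  rw [integratedCountingFn_eq hΛ hl hr]
  obtain ⟨f, hf, hfv⟩ := hAB (fun w => if (w : ℂ) = l then 1 else 0) (fun w => by
    split_ifs <;> simp)
  have hJ := norm_mul_prod_div_dist_le (c := l) (R := |l.im|) hr (neighbours hΛ l |l.im|)
    (f := f) (M := Real.exp (A + B * (2 * |l.im|)))
    (fun w hw => ((mem_neighbours hΛ).1 hw).1) hf.1 (fun w hw => by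
      obtain ⟨h1, h2, -⟩ := (mem_neighbours hΛ).1 hw
      simpa [h1] using hfv ⟨w, h2⟩) (fun z hz => (hf.2 z).trans (by
        have h1 : |z.im - l.im| ≤ |l.im| := by
          have := abs_im_le_norm (z - l)
          rwa [hz, sub_im] at this
        have h2 := abs_sub_abs_le_abs_sub z.im l.im
        have h3 : |z.im| ≤ 2 * |l.im| := by linarith
        gcongr))
  have hfl : f l = 1 := by simpa using hfv ⟨l, hl⟩
  have hd : ∀ w ∈ neighbours hΛ l |l.im|, 0 < |l.im| / dist w l := fun w hw =>
    div_pos hr (dist_pos.2 ((mem_neighbours hΛ).1 hw).1)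
  rw [hfl, norm_one, one_mul] at hJ
  have hlog := Real.log_le_log (Finset.prod_pos hd) hJ
  rw [Real.log_prod fun w hw => (hd w hw).ne', Real.log_exp] at hlog
  have hlog' : Real.log |l.im| + A ≤ (Real.exp (2 * |A|) + 1) * |l.im| := by
    have h1 := Real.log_le_sub_one_of_pos (x := Real.exp (|A|) * |l.im|) (by positivity)
    rw [Real.log_mul (Real.exp_pos _).ne' hr.ne', Real.log_exp] at h1
    have h2 : Real.exp |A| ≤ Real.exp (2 * |A|) :=
      Real.exp_le_exp.2 (by linarith [abs_nonneg A])
    have h3 := le_abs_self A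
    nlinarith
  linarith

/-! ### Necessity of (ii) at positive distance from the line. -/

/-- The half-plane Green function at height ε dominates ε times the Poisson kernel: apply log t ≥ 1
- 1/t to the squared ratio, and use ε ≤ Im w to get |x + iε - conj w| ≤ 2|x - w|. -/
theorem mul_im_div_le_log {ε x : ℝ} {w : ℂ} (hε : 0 < ε) (hw : ε ≤ w.im)
    (hne : (x + ε * I : ℂ) ≠ w) :
    ε * w.im / (2 * ‖(x : ℂ) - w‖ ^ 2) ≤
      Real.log (‖x + ε * I - (starRingEnd ℂ) w‖ / ‖x + ε * I - w‖) := by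
  have hb0 : 0 < w.im := hε.trans_le hw
  have hN : 0 < ‖(x : ℂ) + ε * I - w‖ := norm_pos_iff.2 (sub_ne_zero.2 hne)
  have hq : ‖(x : ℂ) + ε * I - w‖ ^ 2 = (x - w.re) ^ 2 + (ε - w.im) ^ 2 := by
    rw [Complex.sq_norm, normSq_apply]; simp; ring
  have hp : ‖(x : ℂ) + ε * I - (starRingEnd ℂ) w‖ ^ 2 = (x - w.re) ^ 2 + (ε + w.im) ^ 2 := by
    rw [Complex.sq_norm, normSq_apply]; simp; ring
  have hs : ‖(x : ℂ) - w‖ ^ 2 = (x - w.re) ^ 2 + w.im ^ 2 := by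
    rw [Complex.sq_norm, normSq_apply]; simp; ring
  have hq0 : 0 < (x - w.re) ^ 2 + (ε - w.im) ^ 2 := hq ▸ by positivity
  have hp0 : 0 < (x - w.re) ^ 2 + (ε + w.im) ^ 2 := by positivity
  have hlog : Real.log (‖(x : ℂ) + ε * I - (starRingEnd ℂ) w‖ / ‖(x : ℂ) + ε * I - w‖) =
      Real.log (((x - w.re) ^ 2 + (ε + w.im) ^ 2) / ((x - w.re) ^ 2 + (ε - w.im) ^ 2)) / 2 := by
    rw [← hp, ← hq, ← div_pow, Real.log_pow]; push_cast; ring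
  rw [hlog, hs]
  have h1 := Real.one_sub_inv_le_log_of_pos (div_pos hp0 hq0)
  have h2 : 1 - (((x - w.re) ^ 2 + (ε + w.im) ^ 2) / ((x - w.re) ^ 2 + (ε - w.im) ^ 2))⁻¹ =
      4 * ε * w.im / ((x - w.re) ^ 2 + (ε + w.im) ^ 2) := by
    rw [inv_div, eq_div_iff hp0.ne', sub_mul, div_mul_cancel₀ _ hp0.ne']; ring
  rw [h2] at h1
  have h3 : ε * w.im / (2 * ((x - w.re) ^ 2 + w.im ^ 2)) ≤
      2 * ε * w.im / ((x - w.re) ^ 2 + (ε + w.im) ^ 2) := by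
    rw [div_le_div_iff₀ (by positivity) hp0]
    have h4 : (x - w.re) ^ 2 + (ε + w.im) ^ 2 ≤ 4 * ((x - w.re) ^ 2 + w.im ^ 2) := by
      nlinarith [sq_nonneg (x - w.re)]
    have h5 : 0 < ε * w.im := by positivity
    nlinarith
  have h6 : 2 * ε * w.im / ((x - w.re) ^ 2 + (ε + w.im) ^ 2) =
      4 * ε * w.im / ((x - w.re) ^ 2 + (ε + w.im) ^ 2) / 2 := by ring
  linarith

/-- A Carleson type bound for the zeros in the upper half-plane of a function that is `1` at a
real point. -/
theorem HasBernsteinBound.sum_im_div_le {A B : ℝ} {f : ℂ → ℂ} (hf : HasBernsteinBound A B f)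
    (hB : 0 ≤ B) {x ε : ℝ} (hfx : f x = 1) (hε : 0 < ε)
    (hε1 : ε * Real.exp (A + 2 * B) ≤ 1 / 2) (hε2 : ε ≤ 1) (s : Finset ℂ)
    (hs : ∀ w ∈ s, ε ≤ w.im) (h0 : ∀ w ∈ s, f w = 0) :
    ∑ w ∈ s, w.im / ‖(x : ℂ) - w‖ ^ 2 ≤ 2 / ε * (A + B * ε + Real.log 2) := by
  set z : ℂ := x + ε * I with hz
  have hzim : z.im = ε := by simp [hz]
  -- At the real point x the Blaschke factors have modulus 1 and carry no information, so Jensen is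
  -- evaluated at x + iε, where f is still at least 1/2.
  have hfz : 1 / 2 ≤ ‖f z‖ := by
    have hdz : dist z x = ε := by
      rw [dist_eq_norm, hz, add_sub_cancel_left, norm_mul, norm_I, norm_real, mul_one,
        Real.norm_of_nonneg hε.le]
    have h1 := hf.dist_le hB (z := x) (w := z) (by rw [hdz]; exact hε2)
    rw [hdz, hfx, dist_eq_norm, ofReal_im, abs_zero, zero_add, mul_comm B 2] at h1
    have h2 := norm_sub_norm_le (1 : ℂ) (f z)
    rw [norm_one] at h2
    linarith
  have hne : ∀ w ∈ s, z ≠ w := fun w hw h => by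
    rw [h, h0 w hw, norm_zero] at hfz
    linarith
  have hJ := norm_mul_prod_conj_le hB s (f := f) (M := Real.exp A) (z := z)
    (fun w hw => hε.trans_le (hs w hw)) hf.1 h0
    ⟨Real.exp A, fun z hz => by
      rw [← Real.exp_add]
      simpa [abs_of_nonneg hz] using hf.2 z⟩
    (fun x => by simpa using hf.2 x) (by rw [hzim]; exact hε.le)
  rw [hzim, ← Real.exp_add] at hJ
  have hpos : ∀ w ∈ s, 0 < ‖z - w‖ := fun w hw => norm_pos_iff.2 (sub_ne_zero.2 (hne w hw))
  have hpos' : ∀ w ∈ s, 0 < ‖z - (starRingEnd ℂ) w‖ := fun w hw => by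
    refine norm_pos_iff.2 fun h => ?_
    have := congrArg Complex.im h
    rw [sub_im, conj_im, hzim, zero_im] at this
    linarith [hs w hw]
  have hprod : ∏ w ∈ s, (‖z - (starRingEnd ℂ) w‖ / ‖z - w‖) ≤ 2 * Real.exp (A + B * ε) := by
    rw [Finset.prod_div_distrib, div_le_iff₀ (Finset.prod_pos hpos)]
    have : 0 ≤ ∏ w ∈ s, ‖z - (starRingEnd ℂ) w‖ := Finset.prod_nonneg fun _ _ => norm_nonneg _
    nlinarith
  have hlog := Real.log_le_log (Finset.prod_pos fun w hw => div_pos (hpos' w hw) (hpos w hw)) hprod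
  rw [Real.log_prod fun w hw => (div_pos (hpos' w hw) (hpos w hw)).ne',
    Real.log_mul two_ne_zero (Real.exp_pos _).ne', Real.log_exp] at hlog
  have hsum := Finset.sum_le_sum fun w hw => mul_im_div_le_log hε (hs w hw) (hne w hw)
  have heq : ∑ w ∈ s, ε * w.im / (2 * ‖(x : ℂ) - w‖ ^ 2) =
      ε / 2 * ∑ w ∈ s, w.im / ‖(x : ℂ) - w‖ ^ 2 := by
    rw [Finset.mul_sum]
    refine Finset.sum_congr rfl fun w _ => ?_
    rw [mul_div_mul_comm]
  rw [heq] at hsum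
  have h5 : ε / 2 * ∑ w ∈ s, w.im / ‖(x : ℂ) - w‖ ^ 2 ≤ A + B * ε + Real.log 2 := by linarith
  calc _ = 2 / ε * (ε / 2 * ∑ w ∈ s, w.im / ‖(x : ℂ) - w‖ ^ 2) := by field_simp
    _ ≤ _ := by gcongr

theorem HasBernsteinBound.comp_neg {A B : ℝ} {f : ℂ → ℂ} (hf : HasBernsteinBound A B f) :
    HasBernsteinBound A B fun z => f (-z) :=
  ⟨hf.1.comp differentiable_neg, fun z => by simpa using hf.2 (-z)⟩

/-- Zeros in the lower half-plane are moved up by z ↦ -z; the two halves double the constant. -/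
theorem HasBernsteinBound.sum_abs_im_div_le {A B : ℝ} {f : ℂ → ℂ} (hf : HasBernsteinBound A B f)
    (hB : 0 ≤ B) {x ε : ℝ} (hfx : f x = 1) (hε : 0 < ε)
    (hε1 : ε * Real.exp (A + 2 * B) ≤ 1 / 2) (hε2 : ε ≤ 1) (s : Finset ℂ)
    (hs : ∀ w ∈ s, ε ≤ |w.im|) (h0 : ∀ w ∈ s, f w = 0) :
    ∑ w ∈ s, |w.im| / ‖(x : ℂ) - w‖ ^ 2 ≤ 4 / ε * (A + B * ε + Real.log 2) := by
  classical
  have hup := hf.sum_im_div_le hB hfx hε hε1 hε2 (s.filter fun w => 0 ≤ w.im)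
    (fun w hw => by
      rw [Finset.mem_filter] at hw
      simpa [abs_of_nonneg hw.2] using hs w hw.1)
    (fun w hw => h0 w (Finset.mem_filter.1 hw).1)
  have hlo := hf.comp_neg.sum_im_div_le hB (x := -x) (by simpa using hfx) hε hε1 hε2
    ((s.filter fun w => ¬ 0 ≤ w.im).image fun w => -w)
    (fun w hw => by
      obtain ⟨u, hu, rfl⟩ := Finset.mem_image.1 hw
      rw [Finset.mem_filter] at hu
      simpa [abs_of_neg (not_le.1 hu.2)] using hs u hu.1)
    (fun w hw => by
      obtain ⟨u, hu, rfl⟩ := Finset.mem_image.1 hw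
      simpa using h0 u (Finset.mem_filter.1 hu).1)
  rw [Finset.sum_image (neg_injective.injOn)] at hlo
  rw [← Finset.sum_filter_add_sum_filter_not s fun w => 0 ≤ w.im]
  have h1 : ∑ w ∈ s with 0 ≤ w.im, |w.im| / ‖(x : ℂ) - w‖ ^ 2 =
      ∑ w ∈ s with 0 ≤ w.im, w.im / ‖(x : ℂ) - w‖ ^ 2 :=
    Finset.sum_congr rfl fun w hw => by rw [abs_of_nonneg (Finset.mem_filter.1 hw).2]
  have h2 : ∑ w ∈ s with ¬ 0 ≤ w.im, |w.im| / ‖(x : ℂ) - w‖ ^ 2 =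
      ∑ w ∈ s with ¬ 0 ≤ w.im, (-w).im / ‖((-x : ℝ) : ℂ) - (-w)‖ ^ 2 :=
    Finset.sum_congr rfl fun w hw => by
      rw [abs_of_neg (not_le.1 (Finset.mem_filter.1 hw).2), neg_im, ← norm_neg]
      congr 3
      push_cast
      ring
  rw [h1, h2]
  calc _ ≤ _ := add_le_add hup hlo
    _ = _ := by ring

/-- Interpolating sequences at positive distance from the real line satisfy the Carleson
condition. -/
theorem IsInterpolating.carlesonCondition {Λ : Set ℂ} {δ : ℝ} (hδ : 0 < δ)
    (hsep : ∀ l ∈ Λ, δ ≤ |l.im|) (h : IsInterpolating Λ) : CarlesonCondition Λ := by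
  classical
  obtain ⟨A₀, B₀, hB₀, hAB⟩ := h.exists_uniform_bound
  obtain ⟨A, hA⟩ : ∃ A, A = Real.log (2 * (1 + Real.exp A₀ / δ)) := ⟨_, rfl⟩
  have hdist : ∀ (x : ℝ) (l : Λ), δ ≤ ‖(x : ℂ) - l‖ := fun x l => by
    have := abs_im_le_norm ((x : ℂ) - l)
    rw [sub_im, ofReal_im, zero_sub, abs_neg] at this
    exact (hsep l l.2).trans this
  have hex : ∀ x : ℝ, ∃ f, HasBernsteinBound A (B₀ + 1) f ∧ f x = 1 ∧ ∀ l ∈ Λ, f l = 0 := by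
    intro x
    -- (x - z) g(z)/δ is 1 on Λ and 0 at x, so one minus it vanishes on Λ. The factor sin(z - x)/(z
    -- - x) absorbs its linear growth along ℝ at the price of 1 in the type.
    obtain ⟨g, hg, hgv⟩ := hAB (fun l => δ / ((x : ℂ) - l)) (fun l => by
      rw [norm_div, norm_real, Real.norm_of_nonneg hδ.le]
      exact div_le_one_of_le₀ (hdist x l) (norm_nonneg _))
    refine ⟨fun z => (1 - (x - z) * (g z / δ)) * csinc (z - x), ⟨?_, fun z => ?_⟩, ?_, ?_⟩
    · have h1 := hg.1
      have h2 := differentiable_csinc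
      fun_prop
    · have h1 := hg.2 z
      have h2 := norm_csinc_le (z - x)
      have h3 := norm_csinc_mul_norm_le (z - x)
      have him : (z - x).im = z.im := by simp
      rw [him] at h2 h3
      have hexp : Real.exp (A + (B₀ + 1) * |z.im|) =
          2 * (1 + Real.exp A₀ / δ) * (Real.exp (B₀ * |z.im|) * Real.exp |z.im|) := by
        rw [Real.exp_add, hA, Real.exp_log (by positivity), ← Real.exp_add]
        ring_nf
      have h4 : ‖1 - (x - z) * (g z / δ)‖ ≤ 1 + ‖z - x‖ * (‖g z‖ / δ) := by
        refine (norm_sub_le _ _).trans ?_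
        rw [norm_one, norm_mul, norm_div, norm_real, Real.norm_of_nonneg hδ.le, norm_sub_rev]
      have h5 : 1 ≤ Real.exp (B₀ * |z.im|) := Real.one_le_exp (by positivity)
      rw [Real.exp_add] at h1
      rw [norm_mul, hexp]
      have h6 := Real.exp_pos |z.im|
      calc ‖1 - (x - z) * (g z / δ)‖ * ‖csinc (z - x)‖
          ≤ (1 + ‖z - x‖ * (‖g z‖ / δ)) * ‖csinc (z - x)‖ := by gcongr
        _ = ‖csinc (z - x)‖ + (‖csinc (z - x)‖ * ‖z - x‖) * (‖g z‖ / δ) := by ring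
        _ ≤ Real.exp |z.im| + Real.exp |z.im| *
            (Real.exp A₀ * Real.exp (B₀ * |z.im|) / δ) := by gcongr
        _ ≤ Real.exp (B₀ * |z.im|) * Real.exp |z.im| + Real.exp |z.im| *
            (Real.exp A₀ * Real.exp (B₀ * |z.im|) / δ) := by
            gcongr
            exact le_mul_of_one_le_left h6.le h5
        _ = (1 + Real.exp A₀ / δ) * (Real.exp (B₀ * |z.im|) * Real.exp |z.im|) := by ring
        _ ≤ _ := by
            gcongr
            have : 0 ≤ 1 + Real.exp A₀ / δ := by positivity
            linarith
    · simp [csinc_zero]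
    · intro l hl
      have hne : (x : ℂ) - l ≠ 0 := norm_pos_iff.1 (hδ.trans_le (hdist x ⟨l, hl⟩))
      have hδ' : (δ : ℂ) ≠ 0 := ofReal_ne_zero.2 hδ.ne'
      have : g l = δ / ((x : ℂ) - l) := hgv ⟨l, hl⟩
      simp only [this]
      field_simp
      simp
  obtain ⟨ε, hε, hεle⟩ : ∃ ε, 0 < ε ∧ ε ≤ min δ (min 1 (Real.exp (-(A + 2 * (B₀ + 1))) / 2)) :=
    ⟨_, by positivity, le_rfl⟩
  obtain ⟨hεδ, hε1, hε2⟩ : ε ≤ δ ∧ ε ≤ 1 ∧ ε ≤ Real.exp (-(A + 2 * (B₀ + 1))) / 2 := by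
    simpa [le_min_iff] using hεle
  have hεexp : ε * Real.exp (A + 2 * (B₀ + 1)) ≤ 1 / 2 := by
    calc _ ≤ Real.exp (-(A + 2 * (B₀ + 1))) / 2 * Real.exp (A + 2 * (B₀ + 1)) := by gcongr
      _ = 1 / 2 := by rw [div_mul_eq_mul_div, ← Real.exp_add]; simp
  refine lt_of_le_of_lt (iSup_le fun x => ?_)
    (ENNReal.ofReal_lt_top (r := 4 / ε * (A + (B₀ + 1) * ε + Real.log 2)))
  rw [ENNReal.tsum_eq_iSup_sum]
  refine iSup_le fun s => ?_
  rw [← ENNReal.ofReal_sum_of_nonneg fun l _ => by positivity]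
  refine ENNReal.ofReal_le_ofReal ?_
  obtain ⟨f, hf, hfx, hfl⟩ := hex x
  have := hf.sum_abs_im_div_le (by positivity) hfx hε hεexp hε1 (s.image Subtype.val)
    (fun w hw => by
      obtain ⟨l, -, rfl⟩ := Finset.mem_image.1 hw
      exact hεδ.trans (hsep l l.2))
    (fun w hw => by
      obtain ⟨l, -, rfl⟩ := Finset.mem_image.1 hw
      exact hfl l l.2)
  rwa [Finset.sum_image Subtype.val_injective.injOn] at this

/-! ### Discretising the Poisson balayage. -/

/-- Discretisation of a slowly decreasing function by points of a lattice. -/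
theorem exists_lattice_atoms {U : ℝ → ℝ} {n m : ℕ} (hm : 0 < m) (hU : Antitone U)
    (hstep : ∀ x, U x ≤ U (x + 1 / m) + 1) (hbot : Tendsto U atBot (𝓝 n))
    (htop : Tendsto U atTop (𝓝 0)) :
    ∃ γ : ℕ → ℝ, Set.InjOn γ (Finset.Icc 1 (n - 1)) ∧
      (∀ i ∈ Finset.Icc 1 (n - 1), ∃ k : ℤ, γ i = k / m) ∧
      ∀ x, (((Finset.Icc 1 (n - 1)).filter fun i => x < γ i).card : ℝ) ≤ U x ∧
        U x ≤ ((Finset.Icc 1 (n - 1)).filter fun i => x < γ i).card + 2 := by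
  have hm' : (0 : ℝ) < m := by exact_mod_cast hm
  have hU0 : ∀ x, 0 ≤ U x := fun x => hU.le_of_tendsto htop x
  have hUn : ∀ x, U x ≤ n := fun x => hU.ge_of_tendsto hbot x
  -- γ i is the last lattice point where U ≥ i. The level n is left out because U may approach it at
  -- -∞ without reaching it.
  have hex : ∀ i : ℕ, ∃ k : ℤ, i ∈ Finset.Icc 1 (n - 1) →
      (i ≤ U (k / m) ∧ ∀ k' : ℤ, i ≤ U (k' / m) → k' ≤ k) := by
    intro i
    by_cases hi : i ∈ Finset.Icc 1 (n - 1)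
    · rw [Finset.mem_Icc] at hi
      obtain ⟨X, hX⟩ := eventually_atTop.1
        (htop.eventually_lt_const (show (0 : ℝ) < i by exact_mod_cast hi.1))
      obtain ⟨Y, hY⟩ := eventually_atBot.1
        (hbot.eventually_const_lt (show (i : ℝ) < n by
          have : i < n := by omega
          exact_mod_cast this))
      obtain ⟨k, hk1, hk2⟩ := Int.exists_greatest_of_bdd (P := fun k : ℤ => (i : ℝ) ≤ U (k / m))
        ⟨⌈X * m⌉, fun k hk => by
          by_contra! hlt
          have h1 : X * m < k := (Int.le_ceil _).trans_lt (by exact_mod_cast hlt)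
          exact absurd (hX (k / m) ((le_div_iff₀ hm').2 h1.le)) (not_lt.2 hk)⟩
        ⟨⌊Y * m⌋, (hY _ ((div_le_iff₀ hm').2 (Int.floor_le _))).le⟩
      exact ⟨k, fun _ => ⟨hk1, hk2⟩⟩
    · exact ⟨0, fun h => absurd h hi⟩
  choose k hk using hex
  have hnext : ∀ x : ℝ, x < ((⌊m * x⌋ + 1 : ℤ) : ℝ) / m ∧
      ((⌊m * x⌋ + 1 : ℤ) : ℝ) / m ≤ x + 1 / m := by
    intro x
    have h1 := Int.lt_floor_add_one (m * x)
    have h2 := Int.floor_le (m * x)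
    constructor
    · rw [lt_div_iff₀ hm', mul_comm]; push_cast; exact h1
    · rw [div_le_iff₀ hm', add_mul, one_div, inv_mul_cancel₀ hm'.ne', mul_comm x]
      push_cast
      linarith
  refine ⟨fun i => k i / m, ?_, fun i _ => ⟨k i, rfl⟩, fun x => ⟨?_, ?_⟩⟩
  -- U is below i at the next lattice point and drops by at most 1 per step, so U (γ i) ∈ [i, i + 1)
  -- and the γ i are distinct.
  · have hlt : ∀ i ∈ Finset.Icc 1 (n - 1), U (k i / m) < i + 1 := by
      intro i hi
      have h1 : U ((k i + 1 : ℤ) / m) < i := by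
        by_contra! h
        have := (hk i hi).2 _ h
        omega
      have h2 := hstep (k i / m)
      rw [← add_div] at h2
      push_cast at h1
      linarith
    intro i hi j hj hij
    simp only at hij
    have hi1 := (hk i hi).1
    have hi2 := hlt i hi
    have hj1 := (hk j hj).1
    have hj2 := hlt j hj
    rw [hij] at hi1 hi2
    have h1 : (i : ℝ) < j + 1 := by linarith
    have h2 : (j : ℝ) < i + 1 := by linarith
    have h1' : i < j + 1 := by exact_mod_cast h1
    have h2' : j < i + 1 := by exact_mod_cast h2
    omega
  · have hsub : ((Finset.Icc 1 (n - 1)).filter fun i => x < k i / m) ⊆ Finset.Icc 1 ⌊U x⌋₊ := by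
      intro i hi
      rw [Finset.mem_filter] at hi
      refine Finset.mem_Icc.2 ⟨(Finset.mem_Icc.1 hi.1).1, Nat.le_floor ?_⟩
      exact (hk i hi.1).1.trans (hU hi.2.le)
    have := Finset.card_le_card hsub
    rw [Nat.card_Icc, add_tsub_cancel_right] at this
    exact (Nat.cast_le.2 this).trans (Nat.floor_le (hU0 x))
  -- Passing from x to the next lattice point costs at most 1, and the floor costs another: hence
  -- the defect 2.
  · have hqn : ⌊U x⌋₊ ≤ n := Nat.floor_le_of_le (hUn x)
    have hsub : Finset.Icc 1 (⌊U x⌋₊ - 1) ⊆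
        ((Finset.Icc 1 (n - 1)).filter fun i => x < k i / m) := by
      intro i hi
      rw [Finset.mem_Icc] at hi
      have hi' : i ∈ Finset.Icc 1 (n - 1) := Finset.mem_Icc.2 ⟨hi.1, by omega⟩
      refine Finset.mem_filter.2 ⟨hi', (hnext x).1.trans_le ?_⟩
      have h1 : ((i + 1 : ℕ) : ℝ) ≤ U x :=
        (Nat.cast_le.2 (show i + 1 ≤ ⌊U x⌋₊ by omega)).trans (Nat.floor_le (hU0 x))
      have h2 := hU (hnext x).2
      have h3 := (hk i hi').2 (⌊m * x⌋ + 1) (by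
        have := hstep x
        push_cast at h1 h2 ⊢
        linarith)
      gcongr
    have h1 := Finset.card_le_card hsub
    rw [Nat.card_Icc, add_tsub_cancel_right] at h1
    have h2 : ⌊U x⌋₊ ≤ ((Finset.Icc 1 (n - 1)).filter fun i => x < k i / m).card + 1 := by omega
    have h3 := Nat.lt_floor_add_one (U x)
    have h4 : (⌊U x⌋₊ : ℝ) ≤ ((Finset.Icc 1 (n - 1)).filter fun i => x < k i / m).card + 1 := by
      exact_mod_cast h2
    linarith

/-- The harmonic sum of arguments attached to a finite set is discretised by lattice points. -/
theorem exists_atoms_of_balayage {s : Finset ℂ} {M : ℝ} {m : ℕ} (hm : 0 < m) (hMm : M ≤ m)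
    (hs : ∀ w ∈ s, w.im ≠ 0) (hM : ∀ x : ℝ, ∑ w ∈ s, |w.im| / ‖(x : ℂ) - w‖ ^ 2 ≤ M) :
    ∃ (J : Finset ℕ) (γ : ℕ → ℝ), Set.InjOn γ J ∧ (∀ i ∈ J, ∃ k : ℤ, γ i = k / m) ∧
      ∀ x, |∑ w ∈ s, Real.arctan ((w.re - x) / |w.im|) -
        ∑ i ∈ J, (if x < γ i then Real.pi / 2 else -(Real.pi / 2))| ≤ 2 * Real.pi := by
  have hpi := Real.pi_pos
  -- Each w contributes the harmonic measure of (x, ∞) seen from w folded to the upper half-plane.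
  -- Thus -U' is the balayage divided by π, at most m.
  let U : ℝ → ℝ := fun x => ∑ w ∈ s, (Real.arctan ((w.re - x) / |w.im|) / Real.pi + 1 / 2)
  have hder : ∀ x : ℝ, HasDerivAt U (∑ w ∈ s, -(|w.im| / ‖(x : ℂ) - w‖ ^ 2) / Real.pi) x := by
    intro x
    refine HasDerivAt.fun_sum fun w hw => ?_
    have hb : 0 < |w.im| := abs_pos.2 (hs w hw)
    have h1 : HasDerivAt (fun x : ℝ => (w.re - x) / |w.im|) (-1 / |w.im|) x := by
      simpa using ((hasDerivAt_id x).const_sub w.re).div_const |w.im|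
    have h2 := (h1.arctan.div_const Real.pi).add_const (1 / 2)
    convert h2 using 1
    have h3 : ‖(x : ℂ) - w‖ ^ 2 = (w.re - x) ^ 2 + |w.im| ^ 2 := by
      rw [Complex.sq_norm, normSq_apply, sq_abs]; simp; ring
    rw [h3]
    have : (w.re - x) ^ 2 + |w.im| ^ 2 ≠ 0 := by positivity
    field_simp
    ring
  have hanti : Antitone U := by
    refine antitone_of_hasDerivAt_nonpos hder fun x => Finset.sum_nonpos fun w _ => ?_
    have : 0 ≤ |w.im| / ‖(x : ℂ) - w‖ ^ 2 / Real.pi := by positivity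
    rw [neg_div]
    linarith
  have hm' : (0 : ℝ) < m := by exact_mod_cast hm
  have hstep : ∀ x, U x ≤ U (x + 1 / m) + 1 := by
    intro x
    have hmono : Monotone fun x => U x + m * x := by
      refine monotone_of_hasDerivAt_nonneg (f' := fun x =>
        ∑ w ∈ s, -(|w.im| / ‖(x : ℂ) - w‖ ^ 2) / Real.pi + m)
        (fun x => (hder x).add (by simpa using (hasDerivAt_id x).const_mul (m : ℝ)))
        fun x => ?_
      simp only [Pi.zero_apply]
      rw [← Finset.sum_div, Finset.sum_neg_distrib, neg_div]
      have h1 : (∑ w ∈ s, |w.im| / ‖(x : ℂ) - w‖ ^ 2) / Real.pi ≤ m := by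
        rw [div_le_iff₀ hpi]
        have := Real.pi_gt_three
        nlinarith [hM x]
      linarith
    have h2 := hmono (show x ≤ x + 1 / m by
      have : (0 : ℝ) < 1 / m := by positivity
      linarith)
    have h3 : (m : ℝ) * (x + 1 / m) = m * x + 1 := by field_simp
    simp only [h3] at h2
    linarith
  have hbot : Tendsto U atBot (𝓝 s.card) := by
    have : Tendsto U atBot (𝓝 (∑ w ∈ s, ((Real.pi / 2) / Real.pi + 1 / 2))) := by
      refine tendsto_finsetSum _ fun w hw => ?_
      have hb : 0 < |w.im| := abs_pos.2 (hs w hw)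
      refine Tendsto.add_const _ (Tendsto.div_const
        ((tendsto_nhds_of_tendsto_nhdsWithin Real.tendsto_arctan_atTop).comp ?_) _)
      exact (tendsto_atTop_add_const_left _ _ tendsto_neg_atBot_atTop).atTop_div_const hb
    convert this using 2
    have : Real.pi / 2 / Real.pi + 1 / 2 = 1 := by field_simp; norm_num
    simp only [this]
    simp
  have htop : Tendsto U atTop (𝓝 0) := by
    have : Tendsto U atTop (𝓝 (∑ w ∈ s, (-(Real.pi / 2) / Real.pi + 1 / 2))) := by
      refine tendsto_finsetSum _ fun w hw => ?_
      have hb : 0 < |w.im| := abs_pos.2 (hs w hw)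
      refine Tendsto.add_const _ (Tendsto.div_const
        ((tendsto_nhds_of_tendsto_nhdsWithin Real.tendsto_arctan_atBot).comp ?_) _)
      exact (tendsto_atBot_add_const_left _ _ tendsto_neg_atTop_atBot).atBot_div_const hb
    convert this using 2
    have : -(Real.pi / 2) / Real.pi + 1 / 2 = 0 := by field_simp; norm_num
    simp only [this]
    simp
  obtain ⟨γ, hinj, hlat, hN⟩ := exists_lattice_atoms hm hanti hstep hbot htop
  refine ⟨Finset.Icc 1 (s.card - 1), γ, hinj, hlat, fun x => ?_⟩
  obtain ⟨h1, h2⟩ := hN x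
  set N : ℝ := (((Finset.Icc 1 (s.card - 1)).filter fun i => x < γ i).card : ℝ) with hNdef
  have hsum : ∑ i ∈ Finset.Icc 1 (s.card - 1), (if x < γ i then Real.pi / 2 else -(Real.pi / 2))
      = Real.pi * N - Real.pi / 2 * ((s.card - 1 : ℕ) : ℝ) := by
    have : ∀ i ∈ Finset.Icc 1 (s.card - 1), (if x < γ i then Real.pi / 2 else -(Real.pi / 2)) =
        Real.pi * (if x < γ i then 1 else 0) - Real.pi / 2 := fun i _ => by
      split_ifs <;> ring
    rw [Finset.sum_congr rfl this, Finset.sum_sub_distrib, ← Finset.mul_sum, Finset.sum_boole,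
      Finset.sum_const, Nat.card_Icc, add_tsub_cancel_right, nsmul_eq_mul]
    ring
  have hUx : ∑ w ∈ s, Real.arctan ((w.re - x) / |w.im|) =
      Real.pi * U x - Real.pi / 2 * (s.card : ℝ) := by
    simp only [U]
    rw [Finset.sum_add_distrib, ← Finset.sum_div, Finset.sum_const, nsmul_eq_mul]
    field_simp
    ring
  have hcard : ((s.card - 1 : ℕ) : ℝ) ≤ s.card ∧ (s.card : ℝ) ≤ ((s.card - 1 : ℕ) : ℝ) + 1 := by
    constructor
    · exact_mod_cast Nat.sub_le _ _
    · have : s.card ≤ s.card - 1 + 1 := by omega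
      exact_mod_cast this
  -- The error is π(U x - N) ∈ [0, 2π] minus π/2 times a difference of cardinalities that is 0 or 1
  -- (0 for empty `s`, by truncated subtraction).
  rw [hsum, hUx, abs_le]
  constructor <;> nlinarith

/-! ### From bounded argument to comparison of moduli in the half-plane. -/

/-- Maximum principle for a bounded harmonic function with boundary jumps at the γ j. It is applied
to H, whose modulus is the exponential of that function times ∏ (|ζ + iγ|/|ζ + iγ + 1|)^η. The extra
product is at most 1 and vanishes at the jumps, so H is continuous up to the boundary; then η → 0.
-/
theorem arg_sum_le_of_boundary {ι κ : Type*} {S : Finset ι} {p : ι → ℂ} (hp : ∀ i ∈ S, 0 < (p i).re)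
    {J : Finset κ} {γ : κ → ℝ} {σ c : ℝ}
    (h : ∀ x : ℝ, (∀ j ∈ J, γ j ≠ x) →
      σ * (∑ i ∈ S, arg (p i - x * I) - ∑ j ∈ J, arg ((γ j - x : ℝ) * I)) ≤ c)
    {ζ : ℂ} (hζ : 0 < ζ.re) :
    σ * (∑ i ∈ S, arg (ζ + p i) - ∑ j ∈ J, arg (ζ + γ j * I)) ≤ c := by
  let H : ℝ → ℂ → ℂ := fun η ζ => Complex.exp (-σ * I * ∑ i ∈ S, Complex.log (ζ + p i)) *
    ∏ j ∈ J, ((ζ + γ j * I) ^ ((σ * I + η : ℂ)) * Complex.exp (-η * Complex.log (ζ + γ j * I + 1)))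
  have hne1 : ∀ ζ : ℂ, 0 ≤ ζ.re → ∀ j, ζ + γ j * I + 1 ∈ slitPlane := fun ζ hζ j => by
    left; simp; linarith
  have hlp : ∀ ζ : ℂ, 0 ≤ ζ.re → ∀ i ∈ S, ζ + p i ∈ slitPlane := fun ζ hζ i hi => by
    left; simp; linarith [hp i hi]
  -- the factors attached to the points `γ j`
  have hfac : ∀ η : ℝ, 0 < η → ∀ ζ : ℂ, 0 ≤ ζ.re → ∀ j, ζ + γ j * I ≠ 0 →
      ‖(ζ + γ j * I) ^ ((σ * I + η : ℂ)) * Complex.exp (-η * Complex.log (ζ + γ j * I + 1))‖ =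
        (‖ζ + γ j * I‖ / ‖ζ + γ j * I + 1‖) ^ η * Real.exp (-(σ * arg (ζ + γ j * I))) := by
    intro η hη ζ hζ j hj
    have h1 := slitPlane_ne_zero (hne1 ζ hζ j)
    rw [norm_mul, norm_cpow_of_ne_zero hj, Complex.norm_exp, Real.div_rpow (norm_nonneg _)
      (norm_nonneg _), Real.rpow_def_of_pos (norm_pos_iff.2 h1)]
    simp only [add_re, mul_re, ofReal_re, I_re, mul_zero, ofReal_im, I_im, mul_one, sub_self,
      zero_add, add_im, mul_im, add_zero, neg_re, zero_mul, sub_zero, log_re,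
      neg_mul, Real.exp_neg]
    rw [mul_comm σ, mul_comm η]
    field_simp
  have hratio : ∀ ζ : ℂ, 0 ≤ ζ.re → ∀ j, ‖ζ + γ j * I‖ / ‖ζ + γ j * I + 1‖ ≤ 1 := by
    intro ζ hζ j
    refine div_le_one_of_le₀ ?_ (norm_nonneg _)
    rw [Complex.norm_def, Complex.norm_def]
    refine Real.sqrt_le_sqrt ?_
    rw [normSq_apply, normSq_apply]
    simp
    nlinarith
  have hexp : ∀ ζ : ℂ, ‖Complex.exp (-σ * I * ∑ i ∈ S, Complex.log (ζ + p i))‖ =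
      Real.exp (σ * ∑ i ∈ S, arg (ζ + p i)) := by
    intro ζ
    rw [Complex.norm_exp]
    simp [log_im]
  have hnorm : ∀ η : ℝ, 0 < η → ∀ ζ : ℂ, 0 ≤ ζ.re → (∀ j ∈ J, ζ + γ j * I ≠ 0) → ‖H η ζ‖ =
      (∏ j ∈ J, (‖ζ + γ j * I‖ / ‖ζ + γ j * I + 1‖) ^ η) *
        Real.exp (σ * (∑ i ∈ S, arg (ζ + p i) - ∑ j ∈ J, arg (ζ + γ j * I))) := by
    intro η hη ζ hζ hJ
    simp only [H]
    rw [norm_mul, norm_prod, hexp, Finset.prod_congr rfl fun j hj => hfac η hη ζ hζ j (hJ j hj),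
      Finset.prod_mul_distrib, ← Real.exp_sum, Finset.sum_neg_distrib, ← Finset.mul_sum,
      mul_left_comm, ← Real.exp_add, mul_sub, sub_eq_add_neg]
  have hprodle : ∀ η : ℝ, 0 < η → ∀ ζ : ℂ, 0 ≤ ζ.re →
      ∏ j ∈ J, (‖ζ + γ j * I‖ / ‖ζ + γ j * I + 1‖) ^ η ≤ 1 := fun η hη ζ hζ =>
    Finset.prod_le_one (fun j _ => by positivity)
      fun j _ => Real.rpow_le_one (by positivity) (hratio ζ hζ j) hη.le
  have hmain : ∀ η : ℝ, 0 < η → ∀ ζ : ℂ, 0 ≤ ζ.re → ‖H η ζ‖ ≤ Real.exp c := by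
    intro η hη ζ hζ
    refine norm_le_of_bounded_of_imaginary_axis (F := H η)
      (C := Real.exp (|σ| * (S.card * Real.pi + J.card * Real.pi))) ?_ ?_ ?_ hζ
    · have hre : 0 < (σ * I + η : ℂ).re := by simpa using hη
      constructor
      · intro ζ hζ
        have hζ : 0 < ζ.re := hζ
        refine DifferentiableAt.differentiableWithinAt ?_
        refine DifferentiableAt.mul ?_ ?_
        · refine DifferentiableAt.cexp (DifferentiableAt.const_mul ?_ _)
          refine DifferentiableAt.fun_sum fun i hi => ?_
          exact DifferentiableAt.clog (by fun_prop) (hlp ζ hζ.le i hi)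
        · refine DifferentiableAt.fun_finsetProd fun j _ => ?_
          refine DifferentiableAt.mul ?_ ?_
          · exact DifferentiableAt.cpow_const (by fun_prop) (by left; simpa using hζ)
          · refine DifferentiableAt.cexp (DifferentiableAt.const_mul ?_ _)
            exact DifferentiableAt.clog (by fun_prop) (hne1 ζ hζ.le j)
      · rw [closure_setOfPred_lt_re]
        intro ζ hζ
        have hζ : 0 ≤ ζ.re := hζ
        refine ContinuousAt.continuousWithinAt ?_
        refine ContinuousAt.mul ?_ ?_
        · refine ContinuousAt.cexp (ContinuousAt.mul continuousAt_const ?_)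
          refine tendsto_finsetSum _ fun i hi => ?_
          exact ContinuousAt.clog (by fun_prop) (hlp ζ hζ i hi)
        · refine tendsto_finsetProd _ fun j _ => ?_
          refine ContinuousAt.mul ?_ ?_
          · exact ContinuousAt.comp (f := fun ζ : ℂ => ζ + γ j * I)
              (g := fun w : ℂ => w ^ (σ * I + η : ℂ))
              (continuousAt_cpow_const_of_re_pos (by left; simpa using hζ) hre) (by fun_prop)
          · refine ContinuousAt.cexp (ContinuousAt.mul continuousAt_const ?_)
            exact ContinuousAt.clog (by fun_prop) (hne1 ζ hζ j)
    · intro ζ hζ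
      rw [hnorm η hη ζ hζ.le fun j _ h0 => by
        have := congrArg re h0
        simp at this
        linarith]
      have hb : |∑ i ∈ S, arg (ζ + p i) - ∑ j ∈ J, arg (ζ + γ j * I)| ≤
          S.card * Real.pi + J.card * Real.pi := by
        refine (abs_sub _ _).trans (add_le_add ?_ ?_)
        · refine (Finset.abs_sum_le_sum_abs _ _).trans ?_
          rw [← nsmul_eq_mul]
          exact Finset.sum_le_card_nsmul _ _ _ fun i _ => abs_arg_le_pi _
        · refine (Finset.abs_sum_le_sum_abs _ _).trans ?_
          rw [← nsmul_eq_mul]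
          exact Finset.sum_le_card_nsmul _ _ _ fun i _ => abs_arg_le_pi _
      refine (mul_le_of_le_one_left (Real.exp_pos _).le (hprodle η hη ζ hζ.le)).trans ?_
      refine Real.exp_le_exp.2 ((le_abs_self _).trans ?_)
      rw [abs_mul]
      gcongr
    · intro x
      by_cases hx : ∃ j ∈ J, γ j = -x
      · obtain ⟨j, hj, hjx⟩ := hx
        have h0 : H η (x * I) = 0 := by
          refine mul_eq_zero_of_right _ (Finset.prod_eq_zero hj ?_)
          have : (x : ℂ) * I + γ j * I = 0 := by rw [hjx]; push_cast; ring
          rw [this, zero_cpow, zero_mul]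
          intro h
          have := congrArg re h
          simp at this
          linarith
        rw [h0, norm_zero]
        exact (Real.exp_pos _).le
      · push Not at hx
        have hb := h (-x) hx
        have e1 : ∀ i, p i - ((-x : ℝ) : ℂ) * I = x * I + p i := fun i => by push_cast; ring
        have e2 : ∀ j, ((γ j - -x : ℝ) : ℂ) * I = x * I + γ j * I := fun i => by push_cast; ring
        simp only [e1, e2] at hb
        have hx0 : (0 : ℝ) ≤ ((x : ℂ) * I).re := by simp
        rw [hnorm η hη _ hx0 fun j hj h0 => hx j hj (by
          have := congrArg im h0
          simp at this
          linarith)]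
        exact (mul_le_of_le_one_left (Real.exp_pos _).le (hprodle η hη _ hx0)).trans
          (Real.exp_le_exp.2 hb)
  have hJ0 : ∀ j ∈ J, ζ + γ j * I ≠ 0 := fun j _ h0 => by
    have := congrArg re h0
    simp at this
    linarith
  have hlim : Tendsto (fun η : ℝ => (∏ j ∈ J, (‖ζ + γ j * I‖ / ‖ζ + γ j * I + 1‖) ^ η) *
      Real.exp (σ * (∑ i ∈ S, arg (ζ + p i) - ∑ j ∈ J, arg (ζ + γ j * I)))) (𝓝[>] 0)
      (𝓝 ((∏ j ∈ J, (‖ζ + γ j * I‖ / ‖ζ + γ j * I + 1‖) ^ (0 : ℝ)) *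
      Real.exp (σ * (∑ i ∈ S, arg (ζ + p i) - ∑ j ∈ J, arg (ζ + γ j * I))))) := by
    refine (Tendsto.mul_const _ (tendsto_finsetProd _ fun j hj => ?_)).mono_left
      nhdsWithin_le_nhds
    refine Real.continuousAt_const_rpow ?_
    have h1 := norm_pos_iff.2 (hJ0 j hj)
    have h2 := norm_pos_iff.2 (slitPlane_ne_zero (hne1 ζ hζ.le j))
    positivity
  have := le_of_tendsto hlim (b := Real.exp c) (by
    filter_upwards [self_mem_nhdsWithin] with η hη
    rw [← hnorm η hη ζ hζ.le hJ0]
    exact hmain η hη ζ hζ.le)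
  simpa using this

theorem norm_sub_lt_norm_add_conj {a b : ℂ} (ha : 0 < a.re) (hb : 0 < b.re) :
    ‖a - b‖ < ‖a + (starRingEnd ℂ) b‖ := by
  rw [Complex.norm_def, Complex.norm_def]
  refine Real.sqrt_lt_sqrt (normSq_nonneg _) ?_
  rw [normSq_apply, normSq_apply]
  simp
  nlinarith [mul_pos ha hb]

/-- Two-point Schwarz–Pick estimate in the right half-plane. -/
theorem norm_mul_le_of_re_pos {L : ℂ → ℂ} (hL : DifferentiableOn ℂ L {z | 0 < z.re})
    (hre : ∀ z : ℂ, 0 < z.re → 0 < (L z).re) {u v : ℂ} (hu : 0 < u.re) (hv : 0 < v.re) :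
    ‖L u‖ * (u.re * v.re) ≤ ‖L v‖ * ‖u + (starRingEnd ℂ) v‖ ^ 2 := by
  have hne : ∀ {a b : ℂ}, 0 < a.re → 0 < b.re → a + (starRingEnd ℂ) b ≠ 0 := fun ha hb h => by
    have := congrArg re h
    simp at this
    linarith
  let ψ : ℂ → ℂ := fun w => v.re * ((1 + w) / (1 - w)) + v.im * I
  have hψ1 : ∀ w ∈ Metric.ball (0 : ℂ) 1, 1 - w ≠ 0 := fun w hw h => by
    rw [mem_ball_zero_iff, ← sub_eq_zero.1 h, norm_one] at hw
    exact lt_irrefl _ hw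
  have hψ : ∀ w ∈ Metric.ball (0 : ℂ) 1, 0 < (ψ w).re := by
    intro w hw
    have h1 := normSq_pos.2 (hψ1 w hw)
    have h2 : (ψ w).re = v.re * ((1 - normSq w) / normSq (1 - w)) := by
      simp only [ψ, add_re, mul_re, ofReal_re, ofReal_im, zero_mul, sub_zero, I_re, mul_zero, I_im,
        div_re, normSq_apply, sub_im, sub_re, one_re, one_im, add_im]
      ring
    rw [h2]
    have h3 : normSq w < 1 := by
      rw [mem_ball_zero_iff] at hw
      rw [normSq_eq_norm_sq]
      nlinarith [norm_nonneg w]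
    have h4 : 0 < 1 - normSq w := by linarith
    positivity
  have hψd : DifferentiableOn ℂ ψ (Metric.ball 0 1) := by
    intro w hw
    have := hψ1 w hw
    refine DifferentiableAt.differentiableWithinAt ?_
    simp only [ψ]
    fun_prop (disch := assumption)
  have hψ0 : ψ 0 = v := by simp [ψ, re_add_im]
  -- ψ is a Cayley map of the disc with ψ 0 = v. Schwarz's lemma says that L does not increase |u -
  -- v|/|u + conj v| =: r/q, whence |L u|(q - r) ≤ |L v|(q + r), and q² - r² = 4 Re u Re v.
  have hS := norm_le_norm_of_mapsTo_ball (R := 1)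
    (f := fun w => (L (ψ w) - L v) / (L (ψ w) + (starRingEnd ℂ) (L v)))
    (z := (u - v) / (u + (starRingEnd ℂ) v)) ?_ ?_ ?_ ?_
  · have hψu : ψ ((u - v) / (u + (starRingEnd ℂ) v)) = u := by
      have h1 := hne hu hv
      have h2 : 1 - (u - v) / (u + (starRingEnd ℂ) v) = 2 * v.re / (u + (starRingEnd ℂ) v) := by
        rw [eq_div_iff h1, sub_mul, div_mul_cancel₀ _ h1, one_mul]
        have := add_conj v
        push_cast at this
        linear_combination this
      have h3 : (v.re : ℂ) ≠ 0 := ofReal_ne_zero.2 hv.ne'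
      simp only [ψ]
      rw [h2]
      have h4 : (starRingEnd ℂ) v = v.re - v.im * I := by
        apply Complex.ext <;> simp
      rw [h4] at h1 ⊢
      have h5 : v = v.re + v.im * I := (re_add_im v).symm
      field_simp
      linear_combination -h5
    rw [hψu] at hS
    set a := L u
    set b := L v
    have ha := hre u hu
    have hb := hre v hv
    have hN := norm_pos_iff.2 (hne hu hv)
    rw [norm_div, norm_div, div_le_div_iff₀ (norm_pos_iff.2 (hne ha hb)) hN] at hS
    have h1 := norm_sub_norm_le a b
    have h2 := norm_add_le a ((starRingEnd ℂ) b)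
    rw [Complex.norm_conj] at h2
    have h3 : ‖u - v‖ ^ 2 + 4 * (u.re * v.re) = ‖u + (starRingEnd ℂ) v‖ ^ 2 := by
      rw [Complex.sq_norm, Complex.sq_norm, normSq_apply, normSq_apply]
      simp
      ring
    set r := ‖u - v‖
    set q := ‖u + (starRingEnd ℂ) v‖
    have hr : 0 ≤ r := norm_nonneg _
    have hrq : r ≤ q := (norm_sub_lt_norm_add_conj hu hv).le
    have h4 : (‖a‖ - ‖b‖) * q ≤ r * (‖a‖ + ‖b‖) := by
      calc _ ≤ ‖a - b‖ * q := by gcongr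
        _ ≤ _ := hS
        _ ≤ _ := by gcongr
    have h5 : ‖a‖ * (q - r) ≤ ‖b‖ * (q + r) := by linarith
    have h6 : ‖a‖ * (q ^ 2 - r ^ 2) ≤ ‖b‖ * (q + r) ^ 2 := by
      calc ‖a‖ * (q ^ 2 - r ^ 2) = ‖a‖ * (q - r) * (q + r) := by ring
        _ ≤ ‖b‖ * (q + r) * (q + r) := by gcongr
        _ = _ := by ring
    have h7 : (q + r) ^ 2 ≤ 4 * q ^ 2 := by nlinarith
    have h8 : ‖b‖ * (q + r) ^ 2 ≤ ‖b‖ * (4 * q ^ 2) := by gcongr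
    have h9 : q ^ 2 - r ^ 2 = 4 * (u.re * v.re) := by linarith
    rw [h9] at h6
    linarith
  · have hcomp : DifferentiableOn ℂ (fun w => L (ψ w)) (Metric.ball 0 1) :=
      hL.comp hψd fun w hw => hψ w hw
    exact (hcomp.sub_const _).div (hcomp.add_const _) fun w hw =>
      hne (hre _ (hψ w hw)) (hre v hv)
  · intro w hw
    rw [mem_closedBall_zero_iff, norm_div]
    exact div_le_one_of_le₀ (norm_sub_lt_norm_add_conj (hre _ (hψ w hw)) (hre v hv)).le
      (norm_nonneg _)
  · simp [hψ0]
  · rw [norm_div, div_lt_one (norm_pos_iff.2 (hne hu hv))]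
    exact norm_sub_lt_norm_add_conj hu hv

/-- A quotient of linear factors with bounded argument in the right half-plane varies at most
polynomially in the hyperbolic sense. -/
theorem prod_norm_div_le_of_arg_bounded {ι κ : Type*} {S : Finset ι} {p : ι → ℂ}
    (hp : ∀ i ∈ S, 0 < (p i).re) {J : Finset κ} {γ : κ → ℝ}
    (harg : ∀ ζ : ℂ, 0 < ζ.re →
      |∑ i ∈ S, arg (ζ + p i) - ∑ j ∈ J, arg (ζ + γ j * I)| ≤ 2 * Real.pi)
    {u v : ℂ} (hu : 0 < u.re) (hv : 0 < v.re) :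
    (∏ i ∈ S, ‖u + p i‖) / (∏ j ∈ J, ‖u + γ j * I‖) ≤
      (∏ i ∈ S, ‖v + p i‖) / (∏ j ∈ J, ‖v + γ j * I‖) *
        (‖u + (starRingEnd ℂ) v‖ ^ 2 / (u.re * v.re)) ^ 8 := by
  have hlp : ∀ ζ : ℂ, 0 < ζ.re → ∀ i ∈ S, ζ + p i ∈ slitPlane := fun ζ hζ i hi => by
    left; simp; linarith [hp i hi]
  have hlγ : ∀ ζ : ℂ, 0 < ζ.re → ∀ j, ζ + γ j * I ∈ slitPlane := fun ζ hζ j => by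
    left; simpa using hζ
  -- A logarithm of the quotient, with |Im g| ≤ 2π; exp(g/8) then has argument at most π/4 in
  -- modulus, hence positive real part.
  let g : ℂ → ℂ := fun ζ => ∑ i ∈ S, Complex.log (ζ + p i) - ∑ j ∈ J, Complex.log (ζ + γ j * I)
  have hgim : ∀ ζ, (g ζ).im = ∑ i ∈ S, arg (ζ + p i) - ∑ j ∈ J, arg (ζ + γ j * I) := fun ζ => by
    simp [g, log_im]
  have hG : ∀ ζ : ℂ, 0 < ζ.re → ‖Complex.exp (g ζ / 8)‖ ^ 8 =
      (∏ i ∈ S, ‖ζ + p i‖) / (∏ j ∈ J, ‖ζ + γ j * I‖) := by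
    intro ζ hζ
    rw [← norm_pow, ← Complex.exp_nat_mul, Nat.cast_ofNat, mul_div_cancel₀ _ (by norm_num),
      Complex.exp_sub, Complex.exp_sum, Complex.exp_sum, norm_div, norm_prod, norm_prod]
    congr 1
    · exact Finset.prod_congr rfl fun i hi => by rw [exp_log (slitPlane_ne_zero (hlp ζ hζ i hi))]
    · exact Finset.prod_congr rfl fun j _ => by rw [exp_log (slitPlane_ne_zero (hlγ ζ hζ j))]
  have hgd : DifferentiableOn ℂ (fun ζ => Complex.exp (g ζ / 8)) {z | 0 < z.re} := by
    intro ζ hζ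
    refine DifferentiableAt.differentiableWithinAt ?_
    refine DifferentiableAt.cexp (DifferentiableAt.div_const (DifferentiableAt.sub ?_ ?_) _)
    · exact DifferentiableAt.fun_sum fun i hi =>
        DifferentiableAt.clog (by fun_prop) (hlp ζ hζ i hi)
    · exact DifferentiableAt.fun_sum fun j _ =>
        DifferentiableAt.clog (by fun_prop) (hlγ ζ hζ j)
  have hmain := norm_mul_le_of_re_pos hgd (fun ζ hζ => by
    rw [Complex.exp_re]
    refine mul_pos (Real.exp_pos _) (Real.cos_pos_of_mem_Ioo ?_)
    have h1 := harg ζ hζ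
    rw [← hgim, abs_le] at h1
    have h2 : (g ζ / 8).im = (g ζ).im / 8 := by
      rw [show (8 : ℂ) = ((8 : ℝ) : ℂ) by norm_num, div_ofReal_im]
    rw [h2]
    have := Real.pi_pos
    constructor <;> linarith) hu hv
  rw [← hG u hu, ← hG v hv, ← mul_pow]
  gcongr
  rw [← mul_div_assoc, le_div_iff₀ (by positivity)]
  exact hmain

/-! ### Phragmén–Lindelöf in the strip |Im z| < 1. -/

/-- At most exponential growth in the strip `|Im z| < 1`. -/
def HasStripGrowth (f : ℂ → ℂ) : Prop :=
  ∃ N : ℕ, f =O[comap (abs ∘ re) atTop ⊓ 𝓟 (im ⁻¹' Set.Ioo (-1) 1)]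
    fun z => Real.exp (N * |z.re|)

theorem HasStripGrowth.of_bound {f : ℂ → ℂ} (C : ℝ)
    (h : ∀ᶠ z in comap (abs ∘ re) atTop ⊓ 𝓟 (im ⁻¹' Set.Ioo (-1) 1), ‖f z‖ ≤ C) :
    HasStripGrowth f :=
  ⟨0, Asymptotics.IsBigO.of_bound C (by simpa using h)⟩

theorem HasStripGrowth.mul {f g : ℂ → ℂ} (hf : HasStripGrowth f) (hg : HasStripGrowth g) :
    HasStripGrowth fun z => f z * g z := by
  obtain ⟨N, hN⟩ := hf
  obtain ⟨N', hN'⟩ := hg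
  refine ⟨N + N', (hN.mul hN').congr_right fun z => ?_⟩
  rw [← Real.exp_add]
  push_cast
  ring_nf

theorem HasStripGrowth.add {f g : ℂ → ℂ} (hf : HasStripGrowth f) (hg : HasStripGrowth g) :
    HasStripGrowth fun z => f z + g z := by
  obtain ⟨N, hN⟩ := hf
  obtain ⟨N', hN'⟩ := hg
  have hmono : ∀ {k l : ℕ}, k ≤ l → (fun z : ℂ => Real.exp (k * |z.re|))
      =O[comap (abs ∘ re) atTop ⊓ 𝓟 (im ⁻¹' Set.Ioo (-1) 1)] fun z => Real.exp (l * |z.re|) := by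
    intro k l hkl
    refine Asymptotics.IsBigO.of_bound 1 (Eventually.of_forall fun z => ?_)
    rw [Real.norm_of_nonneg (Real.exp_pos _).le, Real.norm_of_nonneg (Real.exp_pos _).le, one_mul]
    have : (k : ℝ) ≤ l := by exact_mod_cast hkl
    gcongr
  exact ⟨max N N', (hN.trans (hmono (le_max_left _ _))).add (hN'.trans (hmono (le_max_right _ _)))⟩

theorem HasStripGrowth.sub_const (w : ℂ) : HasStripGrowth fun z => z - w := by
  refine ⟨1, Asymptotics.IsBigO.of_bound (2 + ‖w‖) ?_⟩
  filter_upwards [mem_inf_of_right (mem_principal_self (im ⁻¹' Set.Ioo (-1 : ℝ) 1))] with z hz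
  have h1 := norm_sub_le z w
  have h2 := norm_le_abs_re_add_abs_im z
  have h3 : |z.im| ≤ 1 := abs_le.2 ⟨hz.1.le, hz.2.le⟩
  have h4 := Real.add_one_le_exp |z.re|
  have h5 := Real.one_le_exp (abs_nonneg z.re)
  rw [Real.norm_of_nonneg (Real.exp_pos _).le, Nat.cast_one, one_mul]
  nlinarith [norm_nonneg w]

theorem HasStripGrowth.const (c : ℂ) : HasStripGrowth fun _ => c :=
  .of_bound ‖c‖ (Eventually.of_forall fun _ => le_rfl)

theorem HasStripGrowth.prod {ι : Type*} (s : Finset ι) {f : ι → ℂ → ℂ}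
    (h : ∀ i ∈ s, HasStripGrowth (f i)) : HasStripGrowth fun z => ∏ i ∈ s, f i z := by
  classical
  induction s using Finset.induction_on with
  | empty => simpa using HasStripGrowth.const 1
  | insert j s hj ih =>
    simp only [Finset.prod_insert hj]
    exact (h j (Finset.mem_insert_self _ _)).mul
      (ih fun i hi => h i (Finset.mem_insert_of_mem hi))

theorem HasStripGrowth.sum {ι : Type*} (s : Finset ι) {f : ι → ℂ → ℂ}
    (h : ∀ i ∈ s, HasStripGrowth (f i)) : HasStripGrowth fun z => ∑ i ∈ s, f i z := by
  classical
  induction s using Finset.induction_on with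
  | empty => simpa using HasStripGrowth.const 0
  | insert j s hj ih =>
    simp only [Finset.sum_insert hj]
    exact (h j (Finset.mem_insert_self _ _)).add
      (ih fun i hi => h i (Finset.mem_insert_of_mem hi))

theorem HasStripGrowth.of_exp_im {f : ℂ → ℂ} {A B : ℝ} (hB : 0 ≤ B)
    (h : ∀ z, ‖f z‖ ≤ A * Real.exp (B * |z.im|)) : HasStripGrowth f := by
  refine .of_bound (A * Real.exp B) ?_
  filter_upwards [mem_inf_of_right (mem_principal_self (im ⁻¹' Set.Ioo (-1 : ℝ) 1))] with z hz
  have hA : 0 ≤ A := by simpa using (norm_nonneg _).trans (h 0)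
  refine (h z).trans ?_
  have h3 : |z.im| ≤ 1 := abs_le.2 ⟨hz.1.le, hz.2.le⟩
  gcongr
  exact mul_le_of_le_one_right hB h3

/-- A bound off the strip `|Im z| < 1` extends to the whole plane. -/
theorem HasStripGrowth.hasBernsteinBound {f : ℂ → ℂ} (hf : HasStripGrowth f)
    (hd : Differentiable ℂ f) {A B : ℝ} (hB : 0 ≤ B)
    (h : ∀ z : ℂ, 1 ≤ |z.im| → ‖f z‖ ≤ Real.exp (A + B * |z.im|)) :
    HasBernsteinBound (A + B) B f := by
  refine ⟨hd, fun z => ?_⟩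
  rcases le_total 1 |z.im| with hz | hz
  · refine (h z hz).trans (Real.exp_le_exp.2 ?_)
    linarith
  · have hz' := abs_le.1 hz
    obtain ⟨N, hN⟩ := hf
    have : ‖f z‖ ≤ Real.exp (A + B) := by
      -- The strip has width 2, so growth exp(N exp(c|Re z|)) is admissible for c < π/2; here c = 1.
      refine PhragmenLindelof.horizontal_strip (a := -1) (b := 1) hd.diffContOnCl
        ⟨1, ?_, N, hN.trans ?_⟩ (fun w hw => ?_) (fun w hw => ?_) hz'.1 hz'.2
      · have := Real.pi_gt_three
        linarith
      · refine Asymptotics.IsBigO.of_bound 1 (Eventually.of_forall fun z => ?_)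
        rw [Real.norm_of_nonneg (Real.exp_pos _).le, Real.norm_of_nonneg (Real.exp_pos _).le,
          one_mul, one_mul]
        have := Real.add_one_le_exp |z.re|
        gcongr
        linarith
      · simpa [hw] using h w (by simp [hw])
      · simpa [hw] using h w (by simp [hw])
    refine this.trans (Real.exp_le_exp.2 ?_)
    have : 0 ≤ B * |z.im| := by positivity
    linarith

/-! ### Folding along the line and the generating function. -/

/-- The point of the right half-plane obtained from `z` by folding along the real line and
rotating. -/
noncomputable def foldRight (z : ℂ) : ℂ := ⟨|z.im|, -z.re⟩

/-- The distance between `z` and the reflection of `w` to the side opposite to `z`. -/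
noncomputable def reflDist (z w : ℂ) : ℝ := ‖foldRight z + (starRingEnd ℂ) (foldRight w)‖

theorem reflDist_sq (z w : ℂ) :
    reflDist z w ^ 2 = (|z.im| + |w.im|) ^ 2 + (z.re - w.re) ^ 2 := by
  rw [reflDist, Complex.sq_norm, normSq_apply]
  simp [foldRight]
  ring

theorem norm_sub_sq_eq (z w : ℂ) : ‖z - w‖ ^ 2 = (z.im - w.im) ^ 2 + (z.re - w.re) ^ 2 := by
  rw [Complex.sq_norm, normSq_apply]
  simp
  ring

theorem reflDist_nonneg (z w : ℂ) : 0 ≤ reflDist z w := norm_nonneg _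

theorem norm_sub_le_reflDist (z w : ℂ) : ‖z - w‖ ≤ reflDist z w := by
  refine le_of_sq_le_sq ?_ (reflDist_nonneg z w)
  rw [norm_sub_sq_eq, reflDist_sq]
  have h1 : |z.im - w.im| ≤ |z.im| + |w.im| := abs_sub _ _
  have h2 : (z.im - w.im) ^ 2 ≤ (|z.im| + |w.im|) ^ 2 := by
    rw [← sq_abs (z.im - w.im)]
    gcongr
  linarith

theorem norm_sub_ofReal (z : ℂ) (t : ℝ) : ‖z - t‖ = ‖foldRight z + t * I‖ := by
  rw [← sq_eq_sq₀ (norm_nonneg _) (norm_nonneg _), norm_sub_sq_eq, Complex.sq_norm, normSq_apply]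
  simp [foldRight]
  ring

theorem arg_eq_arctan {w : ℂ} (hw : 0 < w.re) : arg w = Real.arctan (w.im / w.re) := by
  rw [← tan_arg, Real.arctan_tan]
  · exact (abs_lt.1 ((abs_arg_lt_pi_div_two_iff).2 (Or.inl hw))).1
  · exact (abs_lt.1 ((abs_arg_lt_pi_div_two_iff).2 (Or.inl hw))).2

theorem arg_ofReal_mul_I {t : ℝ} (ht : t ≠ 0) :
    arg (t * I) = if 0 < t then Real.pi / 2 else -(Real.pi / 2) := by
  split_ifs with h
  · rw [arg_real_mul _ h, arg_I]
  · have : (t : ℂ) * I = ((-t : ℝ) : ℂ) * -I := by push_cast; ring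
    have ht' : 0 < -t := neg_pos.2 (lt_of_le_of_ne (not_lt.1 h) ht)
    rw [this, arg_real_mul _ ht', arg_neg_I]

/-- An entire function vanishing on a given finite set, of exponential type controlled by the
Poisson balayage of the set, whose size is controlled on both sides off the real line. -/
theorem exists_generating_function {s : Finset ℂ} {M : ℝ} {m : ℕ} (hm : 0 < m) (hMm : M ≤ m)
    (hs : ∀ w ∈ s, w.im ≠ 0) (hM : ∀ x : ℝ, ∑ w ∈ s, |w.im| / ‖(x : ℂ) - w‖ ^ 2 ≤ M) :
    ∃ E : ℂ → ℂ, Differentiable ℂ E ∧ HasStripGrowth E ∧ (∀ w ∈ s, E w = 0) ∧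
      (∀ v : ℂ, v.im ≠ 0 → v ∉ s → E v ≠ 0) ∧
      ∀ z v : ℂ, z.im ≠ 0 → v.im ≠ 0 →
        ‖E z‖ * (‖Complex.sin (Real.pi * m * v)‖ * ∏ w ∈ s, (‖v - w‖ / reflDist v w)) ≤
          ‖E v‖ * ‖Complex.sin (Real.pi * m * z)‖ *
            (reflDist z v ^ 2 / (|z.im| * |v.im|)) ^ 8 := by
  obtain ⟨J, γ, hinj, hlat, hbd⟩ := exists_atoms_of_balayage hm hMm hs hM
  have hm' : (m : ℂ) ≠ 0 := by exact_mod_cast hm.ne'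
  have hp : ∀ w ∈ s, 0 < ((starRingEnd ℂ) (foldRight w)).re := fun w hw => by
    simpa [foldRight] using hs w hw
  have hbd' : ∀ x : ℝ, (∀ j ∈ J, γ j ≠ x) →
      |∑ w ∈ s, arg ((starRingEnd ℂ) (foldRight w) - x * I) - ∑ j ∈ J, arg ((γ j - x : ℝ) * I)| ≤
        2 * Real.pi := by
    intro x hx
    convert hbd x using 3
    · refine Finset.sum_congr rfl fun w hw => ?_
      rw [arg_eq_arctan (by simpa using hp w hw)]
      simp [foldRight]
    · refine Finset.sum_congr rfl fun j hj => ?_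
      rw [arg_ofReal_mul_I (sub_ne_zero.2 (hx j hj))]
      simp only [sub_pos]
  have harg : ∀ ζ : ℂ, 0 < ζ.re →
      |∑ w ∈ s, arg (ζ + (starRingEnd ℂ) (foldRight w)) - ∑ j ∈ J, arg (ζ + γ j * I)| ≤
        2 * Real.pi := by
    intro ζ hζ
    have h1 := arg_sum_le_of_boundary (σ := 1) (c := 2 * Real.pi) hp (J := J) (γ := γ)
      (fun x hx => by
        have := (abs_le.1 (hbd' x hx)).2
        linarith) hζ
    have h2 := arg_sum_le_of_boundary (σ := -1) (c := 2 * Real.pi) hp (J := J) (γ := γ)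
      (fun x hx => by
        have := (abs_le.1 (hbd' x hx)).1
        linarith) hζ
    exact abs_le.2 ⟨by linarith, by linarith⟩
  -- The γ j are distinct zeros of sin(πmz). E = R ∏ (z - w) puts the points of `s` in their place.
  obtain ⟨R, hR, hRs⟩ := exists_eq_mul_prod_sub J (fun j => (γ j : ℂ))
    (fun i hi j hj h => hinj hi hj (ofReal_injective h))
    (f := fun z => Complex.sin (Real.pi * m * z)) (by fun_prop) (fun j hj => by
      obtain ⟨k, hk⟩ := hlat j hj
      rw [Complex.sin_eq_zero_iff]
      refine ⟨k, ?_⟩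
      rw [hk]
      push_cast
      field_simp)
  have hRgrowth : HasStripGrowth R := by
    refine .of_bound (Real.exp (Real.pi * m)) ?_
    have hev : ∀ᶠ z in comap (abs ∘ re) atTop, ∀ j ∈ J, 1 + |γ j| ≤ |z.re| := by
      rw [Finset.eventually_all]
      intro j _
      exact tendsto_comap.eventually (eventually_ge_atTop (1 + |γ j|))
    filter_upwards [hev.filter_mono inf_le_left,
      mem_inf_of_right (mem_principal_self (im ⁻¹' Set.Ioo (-1 : ℝ) 1))] with z hz hz'
    have h1 : 1 ≤ ∏ j ∈ J, ‖z - γ j‖ := by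
      have : ∀ j ∈ J, (1 : ℝ) ≤ ‖z - γ j‖ := fun j hj => by
        have h2 := abs_re_le_norm (z - γ j)
        rw [sub_re, ofReal_re] at h2
        have h3 := abs_sub_abs_le_abs_sub z.re (γ j)
        linarith [hz j hj]
      simpa using Finset.prod_le_prod (fun _ _ => zero_le_one) this
    have h2 : ‖R z‖ * ∏ j ∈ J, ‖z - γ j‖ = ‖Complex.sin (Real.pi * m * z)‖ := by
      rw [hRs z, norm_mul, norm_prod]
    have h3 := norm_sin_le (Real.pi * m * z)
    have h4 : |(Real.pi * m * z : ℂ).im| ≤ Real.pi * m := by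
      have : (Real.pi * m * z : ℂ).im = Real.pi * m * z.im := by
        rw [← ofReal_natCast, ← ofReal_mul, im_ofReal_mul]
      rw [this, abs_mul, abs_of_nonneg (by positivity)]
      exact mul_le_of_le_one_right (by positivity) (abs_le.2 ⟨hz'.1.le, hz'.2.le⟩)
    have h5 := Real.exp_le_exp.2 h4
    nlinarith [norm_nonneg (R z)]
  have hfold : ∀ z : ℂ, z.im ≠ 0 → 0 < (foldRight z).re := fun z hz => by
    simpa [foldRight] using hz
  have hγne : ∀ z : ℂ, z.im ≠ 0 → ∀ j, 0 < ‖z - γ j‖ := fun z hz j => by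
    refine norm_pos_iff.2 fun h => hz ?_
    have := congrArg im h
    simpa using this
  have hnorm : ∀ z : ℂ, z.im ≠ 0 → ‖R z * ∏ w ∈ s, (z - w)‖ =
      ‖Complex.sin (Real.pi * m * z)‖ * ((∏ w ∈ s, ‖z - w‖) /
        ∏ j ∈ J, ‖foldRight z + γ j * I‖) := by
    intro z hz
    have h2 : ‖R z‖ * ∏ j ∈ J, ‖z - γ j‖ = ‖Complex.sin (Real.pi * m * z)‖ := by
      rw [hRs z, norm_mul, norm_prod]
    have h3 : 0 < ∏ j ∈ J, ‖z - γ j‖ := Finset.prod_pos fun j _ => hγne z hz j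
    rw [← h2, ← Finset.prod_congr rfl fun j _ => norm_sub_ofReal z (γ j), norm_mul, norm_prod]
    field_simp
  have hrefl : ∀ v : ℂ, v.im ≠ 0 → ∀ w, 0 < reflDist v w := fun v hv w => by
    have h1 := abs_pos.2 hv
    have h2 : 0 < reflDist v w ^ 2 := by rw [reflDist_sq]; positivity
    exact lt_of_le_of_ne (reflDist_nonneg v w) fun h => by simp [← h] at h2
  refine ⟨fun z => R z * ∏ w ∈ s, (z - w), by fun_prop,
    hRgrowth.mul (HasStripGrowth.prod s fun w _ => HasStripGrowth.sub_const w),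
    fun w hw => ?_, fun v hv hvs => ?_, fun z v hz hv => ?_⟩
  · exact mul_eq_zero_of_right _ (Finset.prod_eq_zero hw (sub_self w))
  · refine mul_ne_zero (fun h => ?_) (Finset.prod_ne_zero_iff.2 fun w hw h => ?_)
    · have h1 := hRs v
      rw [h, zero_mul, Complex.sin_eq_zero_iff] at h1
      obtain ⟨k, hk⟩ := h1
      have := congrArg im hk
      rw [← ofReal_natCast, ← ofReal_mul, im_ofReal_mul, ← ofReal_intCast, ← ofReal_mul,
        ofReal_im] at this
      have hpi : Real.pi * m ≠ 0 := mul_ne_zero Real.pi_ne_zero (by exact_mod_cast hm.ne')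
      exact (mul_ne_zero hpi hv) this
    · exact hvs (sub_eq_zero.1 h ▸ hw)
  -- The comparison concerns reflected factors. At z they dominate |z - w|; at v the discrepancy is
  -- exactly the Blaschke-type product in the statement.
  · have hG := prod_norm_div_le_of_arg_bounded hp harg (hfold z hz) (hfold v hv)
    have hzG : (∏ w ∈ s, ‖z - w‖) / ∏ j ∈ J, ‖foldRight z + γ j * I‖ ≤
        (∏ w ∈ s, ‖foldRight z + (starRingEnd ℂ) (foldRight w)‖) /
          ∏ j ∈ J, ‖foldRight z + γ j * I‖ := by
      gcongr with w hw
      exact norm_sub_le_reflDist z w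
    have hvG : (∏ w ∈ s, ‖v - w‖) = (∏ w ∈ s, (‖v - w‖ / reflDist v w)) *
        ∏ w ∈ s, ‖foldRight v + (starRingEnd ℂ) (foldRight w)‖ := by
      rw [← Finset.prod_mul_distrib]
      exact Finset.prod_congr rfl fun w _ => (div_mul_cancel₀ _ (hrefl v hv w).ne').symm
    have hb : 0 ≤ ∏ w ∈ s, (‖v - w‖ / reflDist v w) :=
      Finset.prod_nonneg fun w _ => div_nonneg (norm_nonneg _) (reflDist_nonneg v w)
    simp only []
    rw [hnorm z hz, hnorm v hv, hvG]
    have hre : ∀ z, (foldRight z).re = |z.im| := fun z => rfl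
    have hT : ‖foldRight z + (starRingEnd ℂ) (foldRight v)‖ = reflDist z v := rfl
    rw [hre, hre, hT] at hG
    calc _ ≤ ‖Complex.sin (Real.pi * m * z)‖ *
          ((∏ w ∈ s, ‖foldRight v + (starRingEnd ℂ) (foldRight w)‖) /
            (∏ j ∈ J, ‖foldRight v + γ j * I‖) * (reflDist z v ^ 2 / (|z.im| * |v.im|)) ^ 8) *
          (‖Complex.sin (Real.pi * m * v)‖ * ∏ w ∈ s, (‖v - w‖ / reflDist v w)) := by
          gcongr
          exact hzG.trans hG
      _ = _ := by ring

/-! ### Lower bound for the Blaschke product. -/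

/-- If |v - w| ≤ |Im v|/2, then `reflDist v w` ≤ 3|Im v|, and log 3 is absorbed by the Poisson term.
Otherwise log t ≤ (t² - 1)/2 gives 2|Im v||Im w|/|v - w|², and |Re v - w| ≤ 3|v - w| turns 2 into
18. -/
theorem log_reflDist_div_le {v w : ℂ} (hv : v.im ≠ 0) (hw : w.im ≠ 0) (hne : w ≠ v) :
    Real.log (reflDist v w / ‖v - w‖) ≤ 18 * |v.im| * (|w.im| / ‖(v.re : ℂ) - w‖ ^ 2) +
      if dist w v ≤ |v.im| then Real.log (|v.im| / dist w v) else 0 := by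
  have hr : 0 < |v.im| := abs_pos.2 hv
  have hb : 0 < |w.im| := abs_pos.2 hw
  have hd : 0 < ‖v - w‖ := norm_pos_iff.2 (sub_ne_zero.2 hne.symm)
  have hdist : dist w v = ‖v - w‖ := by rw [dist_comm, dist_eq_norm]
  rw [hdist]
  have hR0 : 0 < reflDist v w := hd.trans_le (norm_sub_le_reflDist v w)
  have hx : ‖(v.re : ℂ) - w‖ ^ 2 = |w.im| ^ 2 + (v.re - w.re) ^ 2 := by
    rw [norm_sub_sq_eq, sq_abs]; simp
  have hx0 : 0 < ‖(v.re : ℂ) - w‖ := by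
    refine norm_pos_iff.2 fun h => hw ?_
    simpa using congrArg im h
  have hre : |v.re - w.re| ≤ ‖v - w‖ := by simpa using abs_re_le_norm (v - w)
  have him : |v.im - w.im| ≤ ‖v - w‖ := by simpa using abs_im_le_norm (v - w)
  have hxle : ‖(v.re : ℂ) - w‖ ≤ ‖v - w‖ + |v.im| := by
    have h1 : (v.re : ℂ) - w = (v - w) - v.im * I := by
      nth_rewrite 2 [← re_add_im v]; ring
    rw [h1]
    refine (norm_sub_le _ _).trans ?_
    simp
  by_cases hnear : ‖v - w‖ ≤ |v.im| / 2
  · rw [if_pos (by linarith)]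
    have h1 : |v.im| / 2 ≤ |w.im| := by
      have := abs_sub_abs_le_abs_sub v.im w.im
      linarith
    have h2 : |w.im| ≤ 3 / 2 * |v.im| := by
      have := abs_sub_abs_le_abs_sub w.im v.im
      rw [abs_sub_comm] at this
      linarith
    have h3 : reflDist v w ≤ 3 * |v.im| := by
      refine le_of_sq_le_sq ?_ (by positivity)
      rw [reflDist_sq, ← sq_abs (v.re - w.re)]
      have : |v.re - w.re| ≤ |v.im| / 2 := hre.trans hnear
      nlinarith [abs_nonneg (v.re - w.re)]
    have h4 : Real.log (reflDist v w / ‖v - w‖) ≤ Real.log 3 + Real.log (|v.im| / ‖v - w‖) := by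
      rw [← Real.log_mul (by norm_num) (by positivity), ← mul_div_assoc]
      exact Real.log_le_log (by positivity) (by gcongr)
    have h5 : Real.log 3 ≤ 2 := by
      have := Real.log_le_sub_one_of_pos (show (0 : ℝ) < 3 by norm_num)
      linarith
    have h6 : 2 ≤ 18 * |v.im| * (|w.im| / ‖(v.re : ℂ) - w‖ ^ 2) := by
      rw [← mul_div_assoc, le_div_iff₀ (by positivity)]
      have h7 : ‖(v.re : ℂ) - w‖ ≤ 3 / 2 * |v.im| := by linarith
      have h8 : ‖(v.re : ℂ) - w‖ ^ 2 ≤ (3 / 2 * |v.im|) ^ 2 := by gcongr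
      nlinarith
    linarith
  · push Not at hnear
    have h1 : 0 ≤ if ‖v - w‖ ≤ |v.im| then Real.log (|v.im| / ‖v - w‖) else 0 := by
      split_ifs with h
      · exact Real.log_nonneg ((one_le_div hd).2 h)
      · exact le_rfl
    have h2 : Real.log (reflDist v w / ‖v - w‖) ≤ (reflDist v w ^ 2 / ‖v - w‖ ^ 2 - 1) / 2 := by
      have := Real.log_le_sub_one_of_pos (show 0 < (reflDist v w / ‖v - w‖) ^ 2 by positivity)
      rw [Real.log_pow, div_pow] at this
      push_cast at this
      linarith
    have h3 : reflDist v w ^ 2 - ‖v - w‖ ^ 2 ≤ 4 * |v.im| * |w.im| := by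
      rw [reflDist_sq, norm_sub_sq_eq]
      have : v.im * w.im ≤ |v.im| * |w.im| := by rw [← abs_mul]; exact le_abs_self _
      nlinarith [sq_abs v.im, sq_abs w.im]
    have h4 : (reflDist v w ^ 2 / ‖v - w‖ ^ 2 - 1) / 2 ≤ 2 * |v.im| * |w.im| / ‖v - w‖ ^ 2 := by
      rw [le_div_iff₀ (by positivity)]
      have : (reflDist v w ^ 2 / ‖v - w‖ ^ 2 - 1) / 2 * ‖v - w‖ ^ 2 =
          (reflDist v w ^ 2 - ‖v - w‖ ^ 2) / 2 := by field_simp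
      linarith
    have h5 : 2 * |v.im| * |w.im| / ‖v - w‖ ^ 2 ≤
        18 * |v.im| * (|w.im| / ‖(v.re : ℂ) - w‖ ^ 2) := by
      rw [← mul_div_assoc, div_le_div_iff₀ (by positivity) (by positivity)]
      have h7 : ‖(v.re : ℂ) - w‖ ≤ 3 * ‖v - w‖ := by linarith
      have h8 : ‖(v.re : ℂ) - w‖ ^ 2 ≤ (3 * ‖v - w‖) ^ 2 := by gcongr
      have h9 : 0 < |v.im| * |w.im| := by positivity
      nlinarith
    linarith

/-- Lower bound for the Blaschke product of `Λ \ {l}` at `l`. -/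
theorem exp_le_prod_div_reflDist {Λ : Set ℂ} (hΛ : IsDiscreteSeq Λ) (hreal : ∀ l ∈ Λ, l.im ≠ 0)
    {C M δ : ℝ} (hδ : 0 < δ) (hsep : ∀ l ∈ Λ, δ ≤ |l.im|)
    (hC : ∀ l ∈ Λ, integratedCountingFn Λ l |l.im| ≤ C * |l.im|) {l : ℂ} (hl : l ∈ Λ)
    {s : Finset ℂ} (hs : ∀ w ∈ s, w ∈ Λ) (hls : l ∉ s)
    (hM : ∀ x : ℝ, ∑ w ∈ s, |w.im| / ‖(x : ℂ) - w‖ ^ 2 ≤ M) :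
    Real.exp (-((18 * M + C) * |l.im| + 1 / δ)) ≤ ∏ w ∈ s, (‖l - w‖ / reflDist l w) := by
  classical
  have hr : 0 < |l.im| := abs_pos.2 (hreal l hl)
  have hne : ∀ w ∈ s, w ≠ l := fun w hw h => hls (h ▸ hw)
  have hd : ∀ w ∈ s, 0 < ‖l - w‖ := fun w hw => norm_pos_iff.2 (sub_ne_zero.2 (hne w hw).symm)
  have hR : ∀ w ∈ s, 0 < reflDist l w := fun w hw => (hd w hw).trans_le (norm_sub_le_reflDist l w)
  have hpos : 0 < ∏ w ∈ s, (‖l - w‖ / reflDist l w) :=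
    Finset.prod_pos fun w hw => div_pos (hd w hw) (hR w hw)
  rw [← Real.le_log_iff_exp_le hpos,
    Real.log_prod fun w hw => (div_pos (hd w hw) (hR w hw)).ne']
  have h1 : ∑ w ∈ s, Real.log (‖l - w‖ / reflDist l w) =
      -∑ w ∈ s, Real.log (reflDist l w / ‖l - w‖) := by
    rw [← Finset.sum_neg_distrib]
    exact Finset.sum_congr rfl fun w _ => by rw [← Real.log_inv, inv_div]
  have h2 := Finset.sum_le_sum fun w hw =>
    log_reflDist_div_le (hreal l hl) (hreal w (hs w hw)) (hne w hw)
  rw [Finset.sum_add_distrib, ← Finset.mul_sum] at h2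
  have h3 : ∑ w ∈ s, (if dist w l ≤ |l.im| then Real.log (|l.im| / dist w l) else 0) ≤
      ∑ w ∈ neighbours hΛ l |l.im|, Real.log (|l.im| / dist w l) := by
    rw [← Finset.sum_filter]
    refine Finset.sum_le_sum_of_subset_of_nonneg (fun w hw => ?_) fun w hw _ => ?_
    · rw [Finset.mem_filter] at hw
      exact (mem_neighbours hΛ).2 ⟨hne w hw.1, hs w hw.1, hw.2⟩
    · obtain ⟨hw1, -, hw2⟩ := (mem_neighbours hΛ).1 hw
      exact Real.log_nonneg ((one_le_div (dist_pos.2 hw1)).2 hw2)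
  have h4 := hC l hl
  rw [integratedCountingFn_eq hΛ hl hr] at h4
  -- N contains the term log|Im l| of the centre itself, which is negative when |Im l| < 1.
  have h5 : -Real.log |l.im| ≤ 1 / δ := by
    rw [← Real.log_inv]
    have h6 := Real.log_le_sub_one_of_pos (inv_pos.2 hr)
    have h7 : |l.im|⁻¹ ≤ 1 / δ := by
      rw [one_div]
      exact inv_anti₀ hδ (hsep l hl)
    linarith
  have h8 : 18 * |l.im| * ∑ w ∈ s, |w.im| / ‖(l.re : ℂ) - w‖ ^ 2 ≤ 18 * |l.im| * M := by
    have := hM l.re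
    gcongr
  rw [h1]
  nlinarith

/-! ### Peak functions and interpolation on finite subsets. -/

theorem abs_im_le_norm_sin (w : ℂ) : |w.im| ≤ ‖Complex.sin w‖ := by
  rw [Complex.sin, norm_div, norm_mul, norm_I, mul_one, Complex.norm_ofNat,
    le_div_iff₀ two_pos]
  have h1 : ‖Complex.exp (-w * I)‖ = Real.exp w.im := by rw [Complex.norm_exp]; simp
  have h2 : ‖Complex.exp (w * I)‖ = Real.exp (-w.im) := by rw [Complex.norm_exp]; simp
  have h3 := abs_norm_sub_norm_le (Complex.exp (-w * I)) (Complex.exp (w * I))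
  rw [h1, h2] at h3
  refine le_trans ?_ h3
  rcases le_total 0 w.im with h | h
  · rw [abs_of_nonneg h]
    have h4 := Real.self_le_sinh_iff.2 h
    rw [Real.sinh_eq] at h4
    linarith [le_abs_self (Real.exp w.im - Real.exp (-w.im))]
  · rw [abs_of_nonpos h]
    have h4 := Real.self_le_sinh_iff.2 (neg_nonneg.2 h)
    rw [Real.sinh_eq, neg_neg] at h4
    linarith [neg_le_abs (Real.exp w.im - Real.exp (-w.im))]

theorem one_add_sq_le_two_mul_exp {t : ℝ} (ht : 0 ≤ t) : 1 + t ^ 2 ≤ 2 * Real.exp t := by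
  have := Real.quadratic_le_exp_of_nonneg ht
  linarith

/-- Entire functions concentrated at one point of a finite subset of `Λ`. -/
theorem exists_peak_function {Λ : Set ℂ} (hΛ : IsDiscreteSeq Λ) (hreal : ∀ l ∈ Λ, l.im ≠ 0)
    {C M δ : ℝ} (hδ : 0 < δ) (hsep : ∀ l ∈ Λ, δ ≤ |l.im|)
    (hC : ∀ l ∈ Λ, integratedCountingFn Λ l |l.im| ≤ C * |l.im|) {m : ℕ} (hm : 0 < m)
    (hMm : M ≤ m) {T : Finset ℂ} (hT : ∀ w ∈ T, w ∈ Λ)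
    (hM : ∀ x : ℝ, ∑ w ∈ T, |w.im| / ‖(x : ℂ) - w‖ ^ 2 ≤ M) {l : ℂ} (hl : l ∈ T) :
    ∃ F : ℂ → ℂ, Differentiable ℂ F ∧ HasStripGrowth F ∧ F l = 1 ∧
      (∀ w ∈ T, w ≠ l → F w = 0) ∧ ∀ z : ℂ, 1 ≤ |z.im| →
        ‖F z‖ * (1 + (z.re - l.re) ^ 2) ≤ 2 ^ 26 / δ ^ 9 * Real.exp (1 / δ) *
          Real.exp ((Real.pi * m + 26) * |z.im| + (26 + 18 * M + C) * |l.im|) := by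
  classical
  have hM' : ∀ x : ℝ, ∑ w ∈ T.erase l, |w.im| / ‖(x : ℂ) - w‖ ^ 2 ≤ M := fun x =>
    (Finset.sum_le_sum_of_subset_of_nonneg (Finset.erase_subset _ _)
      fun w _ _ => by positivity).trans (hM x)
  have hlΛ := hT l hl
  have hlim := hreal l hlΛ
  have hTe : ∀ w ∈ T.erase l, w ∈ Λ := fun w hw => hT w (Finset.mem_of_mem_erase hw)
  obtain ⟨E, hE, hEg, hE0, hEne, hEb⟩ := exists_generating_function hm hMm
    (fun w hw => hreal w (hTe w hw)) hM'
  have hEl := hEne l hlim (Finset.notMem_erase l T)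
  have hbl := exp_le_prod_div_reflDist hΛ hreal hδ hsep hC hlΛ hTe (Finset.notMem_erase l T) hM'
  have hm' : (1 : ℝ) ≤ m := by exact_mod_cast hm
  have hpi := Real.pi_gt_three
  have him : ∀ z : ℂ, |(Real.pi * m * z : ℂ).im| = Real.pi * m * |z.im| := fun z => by
    have : (Real.pi * m * z : ℂ).im = Real.pi * m * z.im := by
      rw [← ofReal_natCast, ← ofReal_mul, im_ofReal_mul]
    rw [this, abs_mul, abs_of_nonneg (by positivity)]
  have hsl : δ ≤ ‖Complex.sin (Real.pi * m * l)‖ := by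
    refine le_trans ?_ (abs_im_le_norm_sin _)
    rw [him]
    have h1 := hsep l hlΛ
    have h2 : 1 ≤ Real.pi * m := by nlinarith
    nlinarith
  -- With X = 1 + (Re z - Re l)², the quotient E z / E l may grow like X⁸, and two factors sin w / w
  -- gain one X. Eighteen of them cancel X⁸ and leave decay 1/X.
  refine ⟨fun z => E z / E l * csinc (z - l) ^ 18, ?_, ?_, ?_, fun w hw hwl => ?_, fun z hz => ?_⟩
  · have := differentiable_csinc
    fun_prop
  · simp only [div_eq_mul_inv]
    refine (hEg.mul (HasStripGrowth.const _)).mul ?_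
    refine HasStripGrowth.of_exp_im (A := Real.exp (18 * |l.im|)) (B := 18) (by norm_num) fun z => ?_
    rw [norm_pow]
    calc ‖csinc (z - l)‖ ^ 18 ≤ Real.exp |(z - l).im| ^ 18 := by
          gcongr
          exact norm_csinc_le _
      _ = Real.exp (18 * |(z - l).im|) := by rw [← Real.exp_nat_mul]; norm_num
      _ ≤ Real.exp (18 * (|l.im| + |z.im|)) := by
          gcongr
          rw [sub_im, add_comm]
          exact abs_sub _ _
      _ = _ := by rw [← Real.exp_add, mul_add]
  · simp [csinc_zero, hEl]
  · simp [hE0 w (Finset.mem_erase.2 ⟨hwl, hw⟩)]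
  · have hz0 : z.im ≠ 0 := fun h => by rw [h, abs_zero] at hz; linarith
    have key := hEb z l hz0 hlim
    have hr := hsep l hlΛ
    set y := |z.im|
    set r := |l.im|
    set X := 1 + (z.re - l.re) ^ 2 with hX
    have hX1 : 1 ≤ X := by
      have := sq_nonneg (z.re - l.re)
      linarith
    have hr0 : 0 < r := hδ.trans_le hr
    have hTr : reflDist z l ^ 2 / (y * r) ≤ 2 / δ * X * Real.exp (y + r) := by
      have h1 : reflDist z l ^ 2 ≤ X * (1 + (y + r) ^ 2) := by
        rw [reflDist_sq, hX]
        nlinarith [mul_nonneg (sq_nonneg (z.re - l.re)) (sq_nonneg (|z.im| + |l.im|))]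
      have h2 := one_add_sq_le_two_mul_exp (show 0 ≤ y + r by positivity)
      have h3 : δ ≤ y * r := by nlinarith
      calc _ ≤ X * (1 + (y + r) ^ 2) / (y * r) := by gcongr
        _ ≤ X * (2 * Real.exp (y + r)) / δ := by gcongr
        _ = _ := by ring
    have hsz : ‖Complex.sin (Real.pi * m * z)‖ ≤ Real.exp (Real.pi * m * y) := by
      have := norm_sin_le (Real.pi * m * z)
      rwa [him] at this
    have hq : ‖csinc (z - l)‖ ^ 2 * X ≤ 4 * Real.exp (2 * (y + r)) := by
      have h1 := norm_csinc_mul_one_add_le (z - l)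
      have h2 : |(z - l).im| ≤ y + r := by rw [sub_im]; exact abs_sub _ _
      have h3 : X ≤ (1 + ‖z - l‖) ^ 2 := by
        have h4 := abs_re_le_norm (z - l)
        rw [sub_re] at h4
        have h5 : (z.re - l.re) ^ 2 ≤ ‖z - l‖ ^ 2 := by
          rw [← sq_abs]; gcongr
        nlinarith [norm_nonneg (z - l)]
      calc _ ≤ ‖csinc (z - l)‖ ^ 2 * (1 + ‖z - l‖) ^ 2 := by gcongr
        _ = (‖csinc (z - l)‖ * (1 + ‖z - l‖)) ^ 2 := by ring
        _ ≤ (2 * Real.exp (y + r)) ^ 2 := by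
          have h6 : ‖csinc (z - l)‖ * (1 + ‖z - l‖) ≤ 2 * Real.exp (y + r) :=
            h1.trans (by gcongr)
          exact pow_le_pow_left₀ (by positivity) h6 2
        _ = _ := by rw [mul_pow, ← Real.exp_nat_mul]; norm_num
    have hEl0 : 0 < ‖E l‖ := norm_pos_iff.2 hEl
    have hmain : ‖E z‖ / ‖E l‖ ≤ Real.exp (Real.pi * m * y) *
        (2 / δ * X * Real.exp (y + r)) ^ 8 *
          (Real.exp ((18 * M + C) * r + 1 / δ) / δ) := by
      have h1 : ‖E z‖ * (δ * Real.exp (-((18 * M + C) * r + 1 / δ))) ≤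
          ‖E l‖ * Real.exp (Real.pi * m * y) * (2 / δ * X * Real.exp (y + r)) ^ 8 := by
        refine le_trans ?_ (key.trans ?_)
        · gcongr
        · gcongr
      rw [div_le_iff₀ hEl0]
      rw [Real.exp_neg, ← div_eq_mul_inv, mul_div_assoc', div_le_iff₀ (Real.exp_pos _)] at h1
      calc ‖E z‖ = ‖E z‖ * δ / δ := by field_simp
        _ ≤ (‖E l‖ * Real.exp (Real.pi * m * y) * (2 / δ * X * Real.exp (y + r)) ^ 8 *
          Real.exp ((18 * M + C) * r + 1 / δ)) / δ := by gcongr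
        _ = _ := by ring
    rw [norm_mul, norm_div, norm_pow]
    calc ‖E z‖ / ‖E l‖ * ‖csinc (z - l)‖ ^ 18 * X
        ≤ (Real.exp (Real.pi * m * y) * (2 / δ * X * Real.exp (y + r)) ^ 8 *
          (Real.exp ((18 * M + C) * r + 1 / δ) / δ)) * ‖csinc (z - l)‖ ^ 18 * X := by gcongr
      _ = Real.exp (Real.pi * m * y) * (2 / δ * Real.exp (y + r)) ^ 8 *
          (Real.exp ((18 * M + C) * r + 1 / δ) / δ) * (‖csinc (z - l)‖ ^ 2 * X) ^ 9 := by ring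
      _ ≤ Real.exp (Real.pi * m * y) * (2 / δ * Real.exp (y + r)) ^ 8 *
          (Real.exp ((18 * M + C) * r + 1 / δ) / δ) * (4 * Real.exp (2 * (y + r))) ^ 9 := by gcongr
      _ = 2 ^ 26 / δ ^ 9 * (Real.exp (Real.pi * m * y) * Real.exp (y + r) ^ 8 *
          Real.exp ((18 * M + C) * r + 1 / δ) * Real.exp (2 * (y + r)) ^ 9) := by
          field_simp; norm_num
      _ = _ := by
          rw [mul_assoc (2 ^ 26 / δ ^ 9)]
          congr 1
          rw [← Real.exp_nat_mul, ← Real.exp_nat_mul, ← Real.exp_add, ← Real.exp_add,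
            ← Real.exp_add, ← Real.exp_add]
          congr 1
          push_cast
          ring

/-- A multiplier equal to 1 at l that gains e^{-k|Im l|} at the price of k in the type; its sign
depends on the side of ℝ containing l. -/
theorem norm_exp_sign_le {k : ℝ} (hk : 0 ≤ k) (z l : ℂ) :
    ‖Complex.exp (-(k * SignType.sign l.im) * I * (z - l))‖ ≤
      Real.exp (k * |z.im| - k * |l.im|) := by
  rw [Complex.norm_exp]
  refine Real.exp_le_exp.2 ?_
  have h1 : (-(k * SignType.sign l.im) * I * (z - l) : ℂ).re =
      k * ((SignType.sign l.im : ℝ) * z.im) - k * (SignType.sign l.im * l.im) := by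
    have : ((SignType.sign l.im : SignType) : ℂ) = (((SignType.sign l.im : SignType) : ℝ) : ℂ) := by
      cases SignType.sign l.im <;> simp
    rw [this]
    simp [-sign_mul_self]
    ring
  rw [h1, sign_mul_self]
  have h2 : ((SignType.sign l.im : SignType) : ℝ) * z.im ≤ |z.im| := by
    rcases SignType.sign l.im with _ | _ | _ <;> simp [neg_le_abs, le_abs_self]
  gcongr

/-- Interpolation on finite subsets with uniform constants. -/
theorem exists_interpolation_finset {Λ : Set ℂ} (hΛ : IsDiscreteSeq Λ)
    (hreal : ∀ l ∈ Λ, l.im ≠ 0) {C M δ : ℝ} (hδ : 0 < δ) (hsep : ∀ l ∈ Λ, δ ≤ |l.im|)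
    (hC : ∀ l ∈ Λ, integratedCountingFn Λ l |l.im| ≤ C * |l.im|) (hC0 : 0 ≤ C) (hM0 : 0 < M)
    (hM : ∀ T : Finset ℂ, (∀ w ∈ T, w ∈ Λ) → ∀ x : ℝ,
      ∑ w ∈ T, |w.im| / ‖(x : ℂ) - w‖ ^ 2 ≤ M) {v : ℂ → ℂ} {V K : ℝ} (hK : 0 ≤ K) (hV : 0 < V)
    (hv : ∀ w ∈ Λ, ‖v w‖ ≤ V * Real.exp (K * |w.im|)) :
    ∃ A B : ℝ, 0 ≤ B ∧ ∀ T : Finset ℂ, (∀ w ∈ T, w ∈ Λ) →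
      ∃ f, HasBernsteinBound A B f ∧ ∀ w ∈ T, f w = v w := by
  classical
  obtain ⟨m, hm⟩ := exists_nat_ge (max M 1)
  have hMm : M ≤ m := (le_max_left _ _).trans hm
  have hm0 : 0 < m := by
    have : (1 : ℝ) ≤ m := (le_max_right _ _).trans hm
    exact_mod_cast this
  obtain ⟨P, hP0, hP⟩ : ∃ P : ℝ, 0 < P ∧ P = 2 ^ 26 / δ ^ 9 * Real.exp (1 / δ) :=
    ⟨_, by positivity, rfl⟩
  obtain ⟨B₁, hB₁0, hB₁⟩ : ∃ B₁ : ℝ, 0 ≤ B₁ ∧ B₁ = Real.pi * m + 26 :=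
    ⟨_, by have := Real.pi_pos; positivity, rfl⟩
  -- K + (26 + 18M + C) cancels the growth in |Im l| of the data and of the peak function. The
  -- remaining 1 leaves e^{-|Im l|}, which together with 1/X and |Im l| ≥ δ is bounded by a Poisson
  -- kernel at Re z.
  obtain ⟨k, hk0, hk⟩ : ∃ k : ℝ, 0 ≤ k ∧ k = K + (26 + 18 * M + C) + 1 := ⟨_, by positivity, rfl⟩
  refine ⟨Real.log (V * P * (2 / δ * M)) + (B₁ + k), B₁ + k, by positivity, fun T hT => ?_⟩
  have hpeak := fun l : T => exists_peak_function hΛ hreal hδ hsep hC hm0 hMm hT (hM T hT) l.2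
  choose F hFd hFg hF1 hF0 hFb using hpeak
  let G : T → ℂ → ℂ := fun l z =>
    v l * (F l z * Complex.exp (-(k * SignType.sign (l : ℂ).im) * I * (z - l)))
  refine ⟨fun z => ∑ l, G l z, ?_, fun w hw => ?_⟩
  · refine HasStripGrowth.hasBernsteinBound (HasStripGrowth.sum _ fun l _ => ?_) ?_ (by positivity)
      fun z hz => ?_
    · refine (HasStripGrowth.const _).mul ((hFg l).mul ?_)
      refine HasStripGrowth.of_exp_im (A := 1) hk0 fun z => ?_
      refine (norm_exp_sign_le hk0 z l).trans ?_
      rw [one_mul]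
      gcongr
      have : 0 ≤ k * |(l : ℂ).im| := by positivity
      linarith
    · refine Differentiable.fun_sum fun l _ => ?_
      have := hFd l
      simp only [G]
      fun_prop
    · have hterm : ∀ l : T, ‖G l z‖ ≤ V * P * Real.exp ((B₁ + k) * |z.im|) *
          (2 / δ * (|(l : ℂ).im| / ‖(z.re : ℂ) - l‖ ^ 2)) := by
        intro l
        have hlΛ := hT l l.2
        have h1 := hv l hlΛ
        have h2 := hFb l z hz
        rw [← hP, ← hB₁] at h2
        have h3 := norm_exp_sign_le hk0 z l
        have hb := hsep l hlΛ
        set b := |(l : ℂ).im|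
        set X := 1 + (z.re - (l : ℂ).re) ^ 2 with hX
        have hX0 : 0 < X := by positivity
        have hb0 : 0 < b := hδ.trans_le hb
        have hN : ‖(z.re : ℂ) - l‖ ^ 2 = b ^ 2 + (z.re - (l : ℂ).re) ^ 2 := by
          rw [norm_sub_sq_eq, sq_abs]; simp
        have hN0 : 0 < ‖(z.re : ℂ) - l‖ ^ 2 := by rw [hN]; positivity
        have h4 : Real.exp (-b) / X ≤ 2 / δ * (b / ‖(z.re : ℂ) - l‖ ^ 2) := by
          have h5 := one_add_sq_le_two_mul_exp hb0.le
          have h6 : ‖(z.re : ℂ) - l‖ ^ 2 ≤ X * (1 + b ^ 2) := by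
            rw [hN, hX]
            nlinarith [mul_nonneg (sq_nonneg (z.re - (l : ℂ).re)) (sq_nonneg b)]
          have h7 : Real.exp (-b) / X ≤ 2 / ‖(z.re : ℂ) - l‖ ^ 2 := by
            rw [div_le_div_iff₀ hX0 hN0]
            calc _ ≤ Real.exp (-b) * (X * (2 * Real.exp b)) := by
                  gcongr
                  exact h6.trans (by gcongr)
              _ = Real.exp (-b) * Real.exp b * (2 * X) := by ring
              _ = 2 * X := by rw [← Real.exp_add]; simp
          have h8 : 1 ≤ b / δ := (one_le_div hδ).2 hb
          calc _ ≤ 2 / ‖(z.re : ℂ) - l‖ ^ 2 * 1 := by linarith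
            _ ≤ 2 / ‖(z.re : ℂ) - l‖ ^ 2 * (b / δ) := by gcongr
            _ = _ := by ring
        have h9 : ‖F l z‖ ≤ P * Real.exp (B₁ * |z.im| + (26 + 18 * M + C) * b) / X :=
          (le_div_iff₀ hX0).2 h2
        simp only [G]
        rw [norm_mul, norm_mul]
        calc _ ≤ V * Real.exp (K * b) * (P * Real.exp (B₁ * |z.im| + (26 + 18 * M + C) * b) / X *
              Real.exp (k * |z.im| - k * b)) := by gcongr
          _ = V * P * (Real.exp (K * b) * Real.exp (B₁ * |z.im| + (26 + 18 * M + C) * b) *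
              Real.exp (k * |z.im| - k * b)) / X := by ring
          _ = V * P * (Real.exp ((B₁ + k) * |z.im|) * Real.exp (-b)) / X := by
              rw [← Real.exp_add, ← Real.exp_add, ← Real.exp_add]
              congr 3
              rw [hk]
              ring
          _ = V * P * Real.exp ((B₁ + k) * |z.im|) * (Real.exp (-b) / X) := by ring
          _ ≤ _ := by gcongr
      have hsum : ∑ l : T, |(l : ℂ).im| / ‖(z.re : ℂ) - l‖ ^ 2 ≤ M := by
        have := hM T hT z.re
        rwa [← Finset.sum_coe_sort T fun w => |w.im| / ‖(z.re : ℂ) - w‖ ^ 2] at this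
      rw [Real.exp_add, Real.exp_log (by positivity)]
      calc ‖∑ l, G l z‖ ≤ ∑ l, ‖G l z‖ := norm_sum_le _ _
        _ ≤ ∑ l : T, V * P * Real.exp ((B₁ + k) * |z.im|) *
          (2 / δ * (|(l : ℂ).im| / ‖(z.re : ℂ) - l‖ ^ 2)) := Finset.sum_le_sum fun l _ => hterm l
        _ = V * P * Real.exp ((B₁ + k) * |z.im|) *
          (2 / δ * ∑ l : T, |(l : ℂ).im| / ‖(z.re : ℂ) - l‖ ^ 2) := by
          rw [← Finset.mul_sum, ← Finset.mul_sum]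
        _ ≤ V * P * Real.exp ((B₁ + k) * |z.im|) * (2 / δ * M) := by gcongr
        _ = _ := by ring
  · simp only
    rw [Finset.sum_eq_single (⟨w, hw⟩ : T)]
    · simp [G, hF1 ⟨w, hw⟩]
    · intro l _ hlw
      have : F l w = 0 := hF0 l w hw fun h => hlw (Subtype.ext h.symm)
      simp [G, this]
    · simp

/-! ### From finite subsets to Λ. -/

/-- The Carleson condition in terms of finite sums. -/
theorem CarlesonCondition.exists_sum_le {Λ : Set ℂ} (h : CarlesonCondition Λ) :
    ∃ M : ℝ, 0 < M ∧ ∀ T : Finset ℂ, (∀ w ∈ T, w ∈ Λ) → ∀ x : ℝ,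
      ∑ w ∈ T, |w.im| / ‖(x : ℂ) - w‖ ^ 2 ≤ M := by
  classical
  refine ⟨(⨆ x : ℝ, ∑' l : Λ, ENNReal.ofReal (|(l : ℂ).im| / ‖(x : ℂ) - (l : ℂ)‖ ^ 2)).toReal + 1,
    by positivity, fun T hT x => ?_⟩
  have h1 := le_iSup (fun x : ℝ => ∑' l : Λ,
    ENNReal.ofReal (|(l : ℂ).im| / ‖(x : ℂ) - (l : ℂ)‖ ^ 2)) x
  have h2 := (ENNReal.sum_le_tsum (f := fun l : Λ =>
    ENNReal.ofReal (|(l : ℂ).im| / ‖(x : ℂ) - (l : ℂ)‖ ^ 2)) (T.subtype (· ∈ Λ))).trans h1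
  rw [← ENNReal.ofReal_sum_of_nonneg fun l _ => by positivity,
    Finset.sum_subtype_of_mem (fun w : ℂ => |w.im| / ‖(x : ℂ) - w‖ ^ 2) hT,
    ENNReal.ofReal_le_iff_le_toReal h.ne] at h2
  linarith

/-- The density and Carleson conditions imply interpolation. -/
theorem isInterpolating_of_conditions {Λ : Set ℂ} (hΛ : IsDiscreteSeq Λ)
    (hreal : ∀ l ∈ Λ, l.im ≠ 0) (hD : DensityCondition Λ) (hCar : CarlesonCondition Λ) :
    IsInterpolating Λ := by
  classical
  obtain ⟨C, hC0, hC⟩ := hD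
  obtain ⟨M, hM0, hM⟩ := hCar.exists_sum_le
  -- The term of l in (ii) at x = Re l is 1/|Im l|, so (ii) alone forces positive distance from ℝ.
  have hsep : ∀ l ∈ Λ, 1 / M ≤ |l.im| := by
    intro l hl
    have h1 := hM {l} (by simpa using hl) l.re
    have hr : 0 < |l.im| := abs_pos.2 (hreal l hl)
    have h2 : ‖(l.re : ℂ) - l‖ ^ 2 = |l.im| ^ 2 := by
      rw [norm_sub_sq_eq, sq_abs]; simp
    rw [Finset.sum_singleton, h2, div_le_iff₀ (by positivity)] at h1
    rw [div_le_iff₀ hM0]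
    nlinarith
  rintro v ⟨K, hK, V, hV⟩
  let v' : ℂ → ℂ := fun w => if hw : w ∈ Λ then v ⟨w, hw⟩ else 0
  have hv' : ∀ w ∈ Λ, ‖v' w‖ ≤ max V 1 * Real.exp (K * |w.im|) := by
    intro w hw
    have h1 := hV ⟨⟨w, hw⟩, rfl⟩
    simp only [v', hw, dif_pos]
    simp only at h1
    rw [neg_mul, Real.exp_neg, ← div_eq_mul_inv, div_le_iff₀ (Real.exp_pos _)] at h1
    refine h1.trans ?_
    gcongr
    exact le_max_left _ _
  obtain ⟨A, B, hB, hAB⟩ := exists_interpolation_finset hΛ hreal (one_div_pos.2 hM0) hsep hC hC0.le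
    hM0 hM hK.le (by positivity) hv'
  have hex := fun T : Finset Λ => hAB (T.image Subtype.val) (fun w hw => by
    obtain ⟨l, -, rfl⟩ := Finset.mem_image.1 hw
    exact l.2)
  choose f hf hfv using hex
  -- The limit is taken along an ultrafilter finer than `atTop` on finite subsets: the constants are
  -- uniform, and each prescribed value is eventually attained.
  obtain ⟨g, hg, hgl⟩ := exists_tendsto_ultrafilter (Ultrafilter.of atTop) hB hf
  refine ⟨g, hg.mem_bernstein, fun l => tendsto_nhds_unique (hgl l) ?_⟩
  refine tendsto_const_nhds.congr' ?_
  filter_upwards [Ultrafilter.of_le (atTop : Filter (Finset Λ)) (eventually_ge_atTop {l})] with T hT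
  have hlT : l ∈ T := hT (Finset.mem_singleton_self l)
  rw [hfv T l (Finset.mem_image_of_mem _ hlT)]
  simp [v']

end BernsteinAlgebra

/-- Geometric characterisation of interpolation sequences for the Bernstein algebra. The positive
distance to `ℝ` is used only for the necessity of the Carleson condition (which itself forces it). -/
theorem theoremB (Λ : Set ℂ) (hΛ : BernsteinAlgebra.IsDiscreteSeq Λ)
    (hreal : ∀ l ∈ Λ, l.im ≠ 0) :
    ((∃ δ > (0 : ℝ), ∀ l ∈ Λ, δ ≤ |l.im|) →
      (BernsteinAlgebra.IsInterpolating Λ ↔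
        BernsteinAlgebra.DensityCondition Λ ∧ BernsteinAlgebra.CarlesonCondition Λ)) ∧
    (BernsteinAlgebra.DensityCondition Λ ∧ BernsteinAlgebra.CarlesonCondition Λ →
      BernsteinAlgebra.IsInterpolating Λ) ∧
    (BernsteinAlgebra.IsInterpolating Λ → BernsteinAlgebra.DensityCondition Λ) := by
  have hsuff : BernsteinAlgebra.DensityCondition Λ ∧ BernsteinAlgebra.CarlesonCondition Λ →
      BernsteinAlgebra.IsInterpolating Λ := fun h =>
    BernsteinAlgebra.isInterpolating_of_conditions hΛ hreal h.1 h.2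
  refine ⟨?_, hsuff, fun h => h.densityCondition hΛ hreal⟩
  rintro ⟨δ, hδ, hsep⟩
  exact ⟨fun h => ⟨h.densityCondition hΛ hreal, h.carlesonCondition hδ hsep⟩, hsuff⟩
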